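/- Let $\mathfrak{s}$ be the Schrödinger Lie algebra over $\mathbb{C}$, with basis $e,h,f,p,q,z$, where $z$ is central and $$[h,e]=2e,\quad [h,f]=-2f,\quad [e,f]=h,\quad [e,p]=0,\quad [h,p]=p,\quad [f,p]=q,\quad [e,q]=p,\quad [h,q]=-q,\quad [f,q]=0,\quad [p,q]=z.$$ Let $U=U(\mathfrak{s})$ be its universal enveloping algebra, with center $Z(\mathfrak{s})$. For $\lambda_1,\lambda_2\in\mathbb{C}$ let $\Delta(\lambda_1,\lambda_2)=U\otimes_{U(\mathfrak{b})}\mathbb{C}_\lambda$ be the Verma module, where $\mathfrak{b}=\operatorname{span}\{h,z,e,p\}$ and $\mathbb{C}_\lambda$ is the one-dimensional $\mathfrak{b}$-module on which $h$ acts as $\lambda_1$, $z$ as $\lambda_2$, and $e,p$ act as $0$. Let $U_{(f)}$ be the localization of $U$ at the powers of $f$, and let $S_f=U_{(f)}/U$, a $U$-$U$-bimodule. For a $U$-module $M$ let $\operatorname{EnAr}(M)$ be the $U$-submodule of $S_f\otimes_U M$ consisting of all $m$ with $\dim\mathbb{C}[e]m<\infty$. For $n\in\mathbb{Z}_{\ge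 0}$ and $\lambda_2\in\mathbb{C}\setminus\{0\}$ put $V(n,\lambda_2)=\operatorname{EnAr}(\Delta(n-1,\lambda_2))$. **Corollary.** Suppose $n\in\mathbb{Z}_{\ge 0}$ and $\lambda_2\in\mathbb{C}\setminus\{0\}$. Then the annihilators in $U$ satisfy $$\operatorname{Ann}(V(n,\lambda_2))=\operatorname{Ann}(\Delta(n-1,\lambda_2))=\operatorname{Ann}(\Delta(-n-2,\lambda_2)),$$ and this ideal $I$ is centrally generated, that is, it is generated by $I\cap Z(\mathfrak{s})$. -/

import Mathlib

open scoped TensorProduct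

namespace Schroedinger

attribute [local instance] LieRing.ofAssociativeRing

/-! ## The Schrödinger Lie algebra -/

/-- The underlying space of the Schrödinger Lie algebra over `ℂ`: the element `⟨a, b, c, u, v, w⟩`
is the linear combination `a e + b h + c f + u p + v q + w z` of the basis `e, h, f, p, q, z`. -/
@[ext] structure Sch where
  e : ℂ
  h : ℂ
  f : ℂ
  p : ℂ
  q : ℂ
  z : ℂ

namespace Sch

instance : Zero Sch := ⟨⟨0, 0, 0, 0, 0, 0⟩⟩
instance : Add Sch := ⟨fun x y => ⟨x.e + y.e, x.h + y.h, x.f + y.f, x.p + y.p, x.q + y.q, x.z + y.z⟩⟩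
instance : Neg Sch := ⟨fun x => ⟨-x.e, -x.h, -x.f, -x.p, -x.q, -x.z⟩⟩
instance : SMul ℂ Sch := ⟨fun c x => ⟨c * x.e, c * x.h, c * x.f, c * x.p, c * x.q, c * x.z⟩⟩

/-- The bracket, extended bilinearly from
`[e,f] = h`, `[h,e] = 2e`, `[h,f] = -2f`, `[e,p] = 0`, `[h,p] = p`, `[f,p] = q`,
`[e,q] = p`, `[h,q] = -q`, `[f,q] = 0`, `[p,q] = z`, with `z` central. -/
instance : Bracket Sch Sch := ⟨fun x y =>
  { e := 2 * (x.h * y.e - x.e * y.h)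
    h := x.e * y.f - x.f * y.e
    f := -2 * (x.h * y.f - x.f * y.h)
    p := (x.h * y.p - x.p * y.h) + (x.e * y.q - x.q * y.e)
    q := -(x.h * y.q - x.q * y.h) + (x.f * y.p - x.p * y.f)
    z := x.p * y.q - x.q * y.p }⟩

@[simp] theorem zero_e : (0 : Sch).e = 0 := rfl
@[simp] theorem zero_h : (0 : Sch).h = 0 := rfl
@[simp] theorem zero_f : (0 : Sch).f = 0 := rfl
@[simp] theorem zero_p : (0 : Sch).p = 0 := rfl
@[simp] theorem zero_q : (0 : Sch).q = 0 := rfl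
@[simp] theorem zero_z : (0 : Sch).z = 0 := rfl
@[simp] theorem add_e (x y : Sch) : (x + y).e = x.e + y.e := rfl
@[simp] theorem add_h (x y : Sch) : (x + y).h = x.h + y.h := rfl
@[simp] theorem add_f (x y : Sch) : (x + y).f = x.f + y.f := rfl
@[simp] theorem add_p (x y : Sch) : (x + y).p = x.p + y.p := rfl
@[simp] theorem add_q (x y : Sch) : (x + y).q = x.q + y.q := rfl
@[simp] theorem add_z (x y : Sch) : (x + y).z = x.z + y.z := rfl
@[simp] theorem neg_e (x : Sch) : (-x).e = -x.e := rfl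
@[simp] theorem neg_h (x : Sch) : (-x).h = -x.h := rfl
@[simp] theorem neg_f (x : Sch) : (-x).f = -x.f := rfl
@[simp] theorem neg_p (x : Sch) : (-x).p = -x.p := rfl
@[simp] theorem neg_q (x : Sch) : (-x).q = -x.q := rfl
@[simp] theorem neg_z (x : Sch) : (-x).z = -x.z := rfl
@[simp] theorem smul_e (c : ℂ) (x : Sch) : (c • x).e = c * x.e := rfl
@[simp] theorem smul_h (c : ℂ) (x : Sch) : (c • x).h = c * x.h := rfl
@[simp] theorem smul_f (c : ℂ) (x : Sch) : (c • x).f = c * x.f := rfl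
@[simp] theorem smul_p (c : ℂ) (x : Sch) : (c • x).p = c * x.p := rfl
@[simp] theorem smul_q (c : ℂ) (x : Sch) : (c • x).q = c * x.q := rfl
@[simp] theorem smul_z (c : ℂ) (x : Sch) : (c • x).z = c * x.z := rfl
@[simp] theorem lie_e (x y : Sch) : ⁅x, y⁆.e = 2 * (x.h * y.e - x.e * y.h) := rfl
@[simp] theorem lie_h (x y : Sch) : ⁅x, y⁆.h = x.e * y.f - x.f * y.e := rfl
@[simp] theorem lie_f (x y : Sch) : ⁅x, y⁆.f = -2 * (x.h * y.f - x.f * y.h) := rfl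
@[simp] theorem lie_p (x y : Sch) :
    ⁅x, y⁆.p = (x.h * y.p - x.p * y.h) + (x.e * y.q - x.q * y.e) := rfl
@[simp] theorem lie_q (x y : Sch) :
    ⁅x, y⁆.q = -(x.h * y.q - x.q * y.h) + (x.f * y.p - x.p * y.f) := rfl
@[simp] theorem lie_z (x y : Sch) : ⁅x, y⁆.z = x.p * y.q - x.q * y.p := rfl

instance : AddCommGroup Sch :=
  { AddGroup.ofLeftAxioms
      (fun x y z : Sch => by ext <;> simp <;> ring)
      (fun x : Sch => by ext <;> simp)
      (fun x : Sch => by ext <;> simp) with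
    add_comm := fun x y => by ext <;> simp <;> ring }

instance : Module ℂ Sch where
  one_smul x := by ext <;> simp
  mul_smul a b x := by ext <;> simp <;> ring
  smul_zero a := by ext <;> simp
  smul_add a x y := by ext <;> simp <;> ring
  add_smul a b x := by ext <;> simp <;> ring
  zero_smul x := by ext <;> simp

instance : LieRing Sch where
  add_lie x y w := by ext <;> simp <;> ring
  lie_add x y w := by ext <;> simp <;> ring
  lie_self x := by ext <;> simp <;> ring
  leibniz_lie x y w := by ext <;> simp <;> ring

instance : LieAlgebra ℂ Sch where
  lie_smul c x y := by ext <;> simp <;> ring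

instance : Module.Finite ℂ Sch := by
  let g : Sch →ₗ[ℂ] (Fin 6 → ℂ) :=
    { toFun := fun x => ![x.e, x.h, x.f, x.p, x.q, x.z]
      map_add' := fun x y => by ext i; fin_cases i <;> simp
      map_smul' := fun c x => by ext i; fin_cases i <;> simp }
  refine Module.Finite.of_injective g fun x y hxy => ?_
  ext
  · exact congrFun hxy 0
  · exact congrFun hxy 1
  · exact congrFun hxy 2
  · exact congrFun hxy 3
  · exact congrFun hxy 4
  · exact congrFun hxy 5

end Sch

/-- The universal enveloping algebra of the Schrödinger Lie algebra. -/
abbrev U : Type := UniversalEnvelopingAlgebra ℂ Sch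

noncomputable section

/-- The canonical map from the Schrödinger Lie algebra to its enveloping algebra. -/
abbrev toU : Sch →ₗ⁅ℂ⁆ U := UniversalEnvelopingAlgebra.ι ℂ

/-- The basis element `e`, in the enveloping algebra. -/
def eU : U := toU ⟨1, 0, 0, 0, 0, 0⟩

/-- The basis element `f`, in the enveloping algebra. -/
def fU : U := toU ⟨0, 0, 1, 0, 0, 0⟩

theorem subalgebra_eq_top (S : Subalgebra ℂ U) (hS : ∀ x : Sch, toU x ∈ S) : S = ⊤ := by
  let g : Sch →ₗ⁅ℂ⁆ S :=
    { toFun := fun x => ⟨toU x, hS x⟩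
      map_add' := fun x y => by ext; simp
      map_smul' := fun c x => by ext; simp
      map_lie' := fun {x y} => by
        ext
        simp [LieRing.of_associative_ring_bracket] }
  have hg : S.val.comp (UniversalEnvelopingAlgebra.lift ℂ g) = AlgHom.id ℂ U := by
    apply UniversalEnvelopingAlgebra.hom_ext
    ext x
    simp [g]
  refine Algebra.eq_top_iff.2 fun u => ?_
  have h := congrArg (fun F : U →ₐ[ℂ] U => F u) hg
  simp only [AlgHom.comp_apply, AlgHom.id_apply] at h
  rw [← h]
  exact (UniversalEnvelopingAlgebra.lift ℂ g u).2

/-! ## Tensor products over noncommutative rings -/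

section Balanced

variable (A R B M : Type*) [Ring A] [Algebra ℂ A] [Ring R]
  [AddCommGroup B] [Module ℂ B] [Module A B] [IsScalarTower ℂ A B] [Module Rᵐᵒᵖ B]
  [SMulCommClass A Rᵐᵒᵖ B] [SMulCommClass A ℂ B]
  [AddCommGroup M] [Module ℂ M] [Module R M]

/-- The `A`-submodule of `B ⊗[ℂ] M` generated by the elements `b r ⊗ m - b ⊗ r m`. -/
def balancedRel : Submodule A (B ⊗[ℂ] M) :=
  Submodule.span A {t | ∃ (b : B) (r : R) (m : M),
    t = (MulOpposite.op r • b) ⊗ₜ[ℂ] m - b ⊗ₜ[ℂ] (r • m)}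

/-- The left `A`-module `B ⊗_R M`, for an `A`-`R`-bimodule `B` and a left `R`-module `M`
(all of them complex vector spaces). -/
abbrev BalancedTensor : Type _ := (B ⊗[ℂ] M) ⧸ balancedRel A R B M

end Balanced

/-! ## Verma modules -/

/-- The Lie subalgebra spanned by `h, z, e, p`. -/
def borel : LieSubalgebra ℂ Sch where
  carrier := {x | x.f = 0 ∧ x.q = 0}
  zero_mem' := by simp
  add_mem' := fun {x y} hx hy => by simp_all
  smul_mem' := fun c x hx => by simp_all
  lie_mem' := fun {x y} hx hy => by simp_all

/-- The enveloping algebra of the subalgebra spanned by `h, z, e, p`. -/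
abbrev UB : Type := UniversalEnvelopingAlgebra ℂ borel

/-- The algebra map between enveloping algebras induced by the inclusion. -/
def UBtoU : UB →ₐ[ℂ] U := UniversalEnvelopingAlgebra.lift ℂ (toU.comp borel.incl)

/-- The enveloping algebra as a right module over that of the subalgebra. -/
instance : Module UBᵐᵒᵖ U := Module.compHom U UBtoU.toRingHom.op

instance : SMulCommClass U UBᵐᵒᵖ U where
  smul_comm u r v := (mul_assoc u v (UBtoU r.unop)).symm

/-- The character `h ↦ l₁`, `z ↦ l₂`, `e ↦ 0`, `p ↦ 0` of the subalgebra. -/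
def borelChar (l₁ l₂ : ℂ) : borel →ₗ⁅ℂ⁆ ℂ where
  toFun x := l₁ * x.1.h + l₂ * x.1.z
  map_add' x y := by simp; ring
  map_smul' c x := by simp; ring
  map_lie' := fun {x y} => by
    have hx := x.2
    have hy := y.2
    change x.1.f = 0 ∧ x.1.q = 0 at hx
    change y.1.f = 0 ∧ y.1.q = 0 at hy
    simp [LieRing.of_associative_ring_bracket, hx.1, hx.2, hy.1, hy.2, mul_comm]

/-- The one-dimensional module `ℂ_λ`, where `λ(h) = l₁` and `λ(z) = l₂`. -/
@[nolint unusedArguments]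
def CLam (_l₁ _l₂ : ℂ) : Type := ℂ

instance (l₁ l₂ : ℂ) : AddCommGroup (CLam l₁ l₂) := inferInstanceAs (AddCommGroup ℂ)
instance (l₁ l₂ : ℂ) : Module ℂ (CLam l₁ l₂) := inferInstanceAs (Module ℂ ℂ)
instance (l₁ l₂ : ℂ) : Module UB (CLam l₁ l₂) :=
  Module.compHom ℂ (UniversalEnvelopingAlgebra.lift ℂ (borelChar l₁ l₂)).toRingHom

/-- The Verma module `Δ(l₁, l₂)`, induced from `ℂ_λ`. -/
abbrev Verma (l₁ l₂ : ℂ) : Type := BalancedTensor U UB U (CLam l₁ l₂)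

/-! ## Localization of the enveloping algebra at the powers of `f` -/

section Ore

variable {A : Type*} [Ring A]

/-- The map `r ↦ x r - r x`. -/
def adMap (x : A) : A →+ A := AddMonoidHom.mulLeft x - AddMonoidHom.mulRight x

theorem adMap_apply (x r : A) : adMap x r = x * r - r * x := rfl

theorem adMap_iterate_mul (x : A) (N : ℕ) : ∀ (a b : ℕ) (r s : A), a + b = N →
    (adMap x)^[a] r = 0 → (adMap x)^[b] s = 0 → (adMap x)^[N] (r * s) = 0 := by
  induction N with
  | zero =>
    intro a b r s hab hr hs
    obtain ⟨rfl, rfl⟩ : a = 0 ∧ b = 0 := by omega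
    simp_all
  | succ N ih =>
    intro a b r s hab hr hs
    rcases a with _ | a
    · simp only [Function.iterate_zero, id] at hr
      simp [hr, iterate_map_zero]
    rcases b with _ | b
    · simp only [Function.iterate_zero, id] at hs
      simp [hs, iterate_map_zero]
    have h : adMap x (r * s) = adMap x r * s + r * adMap x s := by
      simp only [adMap_apply]; noncomm_ring
    rw [Function.iterate_succ_apply, h, iterate_map_add,
      ih a (b + 1) _ _ (by omega) (by rwa [← Function.iterate_succ_apply]) hs,
      ih (a + 1) b _ _ (by omega) hr (by rwa [← Function.iterate_succ_apply]), add_zero]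

theorem exists_pow_mul (x : A) (k : ℕ) : ∀ (r : A), (adMap x)^[k] r = 0 →
    ∀ n : ℕ, ∃ r' : A, x ^ (n + k) * r = r' * x ^ n := by
  induction k with
  | zero => intro r hr n; exact ⟨0, by simp_all⟩
  | succ k ihk =>
    intro r hr n
    induction n with
    | zero => exact ⟨x ^ (0 + (k + 1)) * r, by simp⟩
    | succ n ihn =>
      obtain ⟨r₁, h₁⟩ := ihn
      obtain ⟨r₂, h₂⟩ := ihk (adMap x r) (by rwa [← Function.iterate_succ_apply]) (n + 1)
      refine ⟨r₁ + r₂, ?_⟩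
      have hxr : x * r = r * x + adMap x r := by simp only [adMap_apply]; noncomm_ring
      have e₁ : n + 1 + (k + 1) = (n + (k + 1)) + 1 := by ring
      have e₂ : n + (k + 1) = n + 1 + k := by ring
      rw [e₁, pow_succ, mul_assoc, hxr, mul_add, ← mul_assoc, h₁, e₂, h₂, add_mul, mul_assoc,
        ← pow_succ]

theorem pow_mul_eq_zero (x : A) (k : ℕ) : ∀ (n : ℕ) (r : A), (adMap x)^[k] r = 0 →
    r * x ^ n = 0 → x ^ (n + k) * r = 0 := by
  induction k with
  | zero => intro n r hr _; simp_all
  | succ k ihk =>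
    intro n
    induction n with
    | zero => intro r _ h; simp_all
    | succ n ihn =>
      intro r hr h
      have hxr : x * r = r * x + adMap x r := by simp only [adMap_apply]; noncomm_ring
      have e₁ : n + 1 + (k + 1) = (n + (k + 1)) + 1 := by ring
      have e₂ : n + (k + 1) = n + 1 + k := by ring
      have hc : ∀ (j : ℕ) (s : A), (adMap x)^[j] (s * x) = (adMap x)^[j] s * x := by
        intro j
        induction j with
        | zero => intro s; rfl
        | succ j ih =>
          intro s
          have : adMap x (s * x) = adMap x s * x := by simp only [adMap_apply]; noncomm_ring
          rw [Function.iterate_succ_apply, this, ih, ← Function.iterate_succ_apply]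
      have h₁ : x ^ (n + (k + 1)) * (r * x) = 0 :=
        ihn (r * x) (by rw [hc, hr, zero_mul]) (by rw [mul_assoc, ← pow_succ', h])
      have h₂ : x ^ (n + 1 + k) * adMap x r = 0 := by
        refine ihk (n + 1) _ (by rwa [← Function.iterate_succ_apply]) ?_
        rw [adMap_apply, sub_mul, mul_assoc, h, mul_zero, zero_sub, mul_assoc, ← pow_succ',
          pow_succ, ← mul_assoc, h, zero_mul, neg_zero]
      rw [e₁, pow_succ, mul_assoc, hxr, mul_add, h₁, e₂, h₂, add_zero]

theorem nonempty_oreSet_powers (x : A) (hx : ∀ r : A, ∃ k : ℕ, (adMap x)^[k] r = 0) :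
    Nonempty (OreLocalization.OreSet (Submonoid.powers x)) := by
  rw [OreLocalization.nonempty_oreSet_iff]
  constructor
  · rintro r₁ r₂ ⟨_, n, rfl⟩ h
    obtain ⟨k, hk⟩ := hx (r₁ - r₂)
    refine ⟨⟨x ^ (n + k), n + k, rfl⟩, ?_⟩
    have h' := pow_mul_eq_zero x k n (r₁ - r₂) hk (by
      rw [sub_mul, sub_eq_zero]; exact h)
    rwa [mul_sub, sub_eq_zero] at h'
  · rintro r ⟨_, n, rfl⟩
    obtain ⟨k, hk⟩ := hx r
    obtain ⟨r', h⟩ := exists_pow_mul x k r hk n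
    exact ⟨r', ⟨x ^ (n + k), n + k, rfl⟩, h⟩

end Ore

theorem adMap_fU_toU (x : Sch) : adMap fU (toU x) = toU ⁅(⟨0, 0, 1, 0, 0, 0⟩ : Sch), x⁆ := by
  rw [LieHom.map_lie, LieRing.of_associative_ring_bracket]
  rfl

theorem adMap_fU_nilpotent (r : U) : ∃ k : ℕ, (adMap fU)^[k] r = 0 := by
  let S : Subalgebra ℂ U :=
    { carrier := {r | ∃ k : ℕ, (adMap fU)^[k] r = 0}
      mul_mem' := by
        rintro a b ⟨k, hk⟩ ⟨l, hl⟩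
        exact ⟨k + l, adMap_iterate_mul fU (k + l) k l a b rfl hk hl⟩
      add_mem' := by
        rintro a b ⟨k, hk⟩ ⟨l, hl⟩
        refine ⟨k + l, ?_⟩
        rw [iterate_map_add, Nat.add_comm k l, Function.iterate_add_apply, hk, iterate_map_zero,
          Nat.add_comm l k, Function.iterate_add_apply, hl, iterate_map_zero, add_zero]
      algebraMap_mem' := fun c => ⟨1, by
        rw [Function.iterate_one, adMap_apply, Algebra.commutes, sub_self]⟩ }
  have hS : S = ⊤ := subalgebra_eq_top S fun x => ⟨3, by
    have h0 : ⁅(⟨0, 0, 1, 0, 0, 0⟩ : Sch), ⁅(⟨0, 0, 1, 0, 0, 0⟩ : Sch),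
        ⁅(⟨0, 0, 1, 0, 0, 0⟩ : Sch), x⁆⁆⁆ = 0 := by ext <;> simp
    rw [Function.iterate_succ_apply, Function.iterate_succ_apply, Function.iterate_one,
      adMap_fU_toU, adMap_fU_toU, adMap_fU_toU, h0, map_zero]⟩
  have : r ∈ S := hS ▸ Algebra.mem_top
  exact this

/-- The powers of `f` satisfy the Ore conditions in the enveloping algebra. -/
instance oreSetF : OreLocalization.OreSet (Submonoid.powers fU) :=
  (nonempty_oreSet_powers fU adMap_fU_nilpotent).some

/-- The localization `U_(f)` of the enveloping algebra at the powers of `f`; its left `U`-module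
structure is multiplication on the left. -/
abbrev Uf : Type := OreLocalization (Submonoid.powers fU) U

/-- The canonical ring homomorphism `U → U_(f)`. -/
abbrev UtoUf : U →+* Uf := OreLocalization.numeratorRingHom

/-- The image of `U` in `U_(f)`, as a left `U`-submodule. -/
def imageU : Submodule U Uf := LinearMap.range (LinearMap.toSpanSingleton U Uf 1)

/-- The quotient `S_f = U_(f) / U`, a `U`-`U`-bimodule. Its left module structure is that of the
quotient of a left `U`-module by a submodule. -/
abbrev Sf : Type := Uf ⧸ imageU

theorem mem_imageU {x : Uf} : x ∈ imageU ↔ ∃ u : U, UtoUf u = x := by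
  have h : ∀ u : U, u • (1 : Uf) = UtoUf u := fun u => by
    rw [← OreLocalization.oreDiv_one_smul (S := Submonoid.powers fU), smul_eq_mul, mul_one]
    rfl
  simp [imageU, LinearMap.mem_range, LinearMap.toSpanSingleton_apply, h]

/-- Multiplication by `r ∈ U` on the right, as a left `U`-linear endomorphism of `S_f`. -/
def rightMul (r : U) : Sf →ₗ[U] Sf :=
  imageU.mapQ imageU
    { toFun := fun x => x * UtoUf r
      map_add' := fun x y => add_mul x y _
      map_smul' := fun u x => smul_mul_assoc u x _ }
    (fun x hx => by
      obtain ⟨u, rfl⟩ := mem_imageU.1 hx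
      exact mem_imageU.2 ⟨u * r, map_mul UtoUf u r⟩)

theorem rightMul_mk (r : U) (x : Uf) :
    rightMul r (Submodule.Quotient.mk x) = Submodule.Quotient.mk (x * UtoUf r) := rfl

/-- The right `U`-module structure of `S_f`, by multiplication on the right. -/
instance : Module Uᵐᵒᵖ Sf where
  smul r x := rightMul r.unop x
  one_smul x := by
    induction x using Submodule.Quotient.induction_on with | _ x =>
    change rightMul 1 _ = _
    rw [rightMul_mk, map_one, mul_one]
  mul_smul r s x := by
    induction x using Submodule.Quotient.induction_on with | _ x =>
    change rightMul (s.unop * r.unop) _ = rightMul r.unop (rightMul s.unop _)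
    rw [rightMul_mk, rightMul_mk, rightMul_mk, map_mul, mul_assoc]
  smul_zero r := map_zero (rightMul r.unop)
  smul_add r x y := map_add (rightMul r.unop) x y
  add_smul r s x := by
    induction x using Submodule.Quotient.induction_on with | _ x =>
    change rightMul (r.unop + s.unop) _ = rightMul r.unop _ + rightMul s.unop _
    rw [rightMul_mk, rightMul_mk, rightMul_mk, map_add, mul_add, Submodule.Quotient.mk_add]
  zero_smul x := by
    induction x using Submodule.Quotient.induction_on with | _ x =>
    change rightMul 0 _ = _
    rw [rightMul_mk, map_zero, mul_zero, Submodule.Quotient.mk_zero]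

instance : SMulCommClass U Uᵐᵒᵖ Sf where
  smul_comm u r x := ((rightMul r.unop).map_smul u x).symm

/-! ## The completion functor -/

section Completion

variable (M : Type*) [AddCommGroup M] [Module ℂ M] [Module U M] [IsScalarTower ℂ U M]

/-- The space `ℂ[e] m`. -/
def orbitSpan {M : Type*} [AddCommGroup M] [Module ℂ M] [Module U M] (m : M) : Submodule ℂ M :=
  Submodule.span ℂ (Set.range fun k : ℕ => eU ^ k • m)

variable {M} in
theorem finite_orbitSpan_iff (m : M) : FiniteDimensional ℂ (orbitSpan m) ↔
    ∃ N : Submodule ℂ M, FiniteDimensional ℂ N ∧ m ∈ N ∧ ∀ y ∈ N, eU • y ∈ N := by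
  constructor
  · intro h
    refine ⟨orbitSpan m, h, Submodule.subset_span ⟨0, by simp⟩, fun y hy => ?_⟩
    induction hy using Submodule.span_induction with
    | mem y hy =>
      obtain ⟨k, rfl⟩ := hy
      exact Submodule.subset_span ⟨k + 1, by simp only [pow_succ', mul_smul]⟩
    | zero => simp
    | add y z _ _ hy hz => rw [smul_add]; exact add_mem hy hz
    | smul c y _ hy =>
      rw [← algebraMap_smul U c y, ← mul_smul, ← Algebra.commutes, mul_smul, algebraMap_smul]
      exact Submodule.smul_mem _ c hy
  · rintro ⟨N, hN, hm, he⟩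
    have h : orbitSpan m ≤ N := by
      refine Submodule.span_le.2 ?_
      rintro _ ⟨k, rfl⟩
      induction k with
      | zero => simpa using hm
      | succ k ih =>
        simp only [pow_succ', mul_smul]
        exact he _ ih
    exact Submodule.finiteDimensional_of_le h

theorem finite_orbitSpan_toU_smul (x : Sch) (m : M) (hm : FiniteDimensional ℂ (orbitSpan m)) :
    FiniteDimensional ℂ (orbitSpan (toU x • m)) := by
  obtain ⟨N, hN, hmN, he⟩ := (finite_orbitSpan_iff m).1 hm
  rw [finite_orbitSpan_iff]
  let act : Sch →ₗ[ℂ] M →ₗ[ℂ] M :=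
    (Algebra.lsmul ℂ ℂ M).toLinearMap.comp (toU : Sch →ₗ[ℂ] U)
  have hact : ∀ (y : Sch) (n : M), act y n = toU y • n := fun _ _ => rfl
  let P : Submodule ℂ M := Submodule.map₂ act ⊤ N
  refine ⟨P, ?_, Submodule.apply_mem_map₂ act Submodule.mem_top hmN, fun w hw => ?_⟩
  · exact (Submodule.fg_iff_finiteDimensional _).1 <| Submodule.FG.map₂ _
      (Module.Finite.fg_top) ((Submodule.fg_iff_finiteDimensional _).2 hN)
  · have hP : P ≤ P.comap (Algebra.lsmul ℂ ℂ M eU) := by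
      refine Submodule.map₂_le.2 fun y _ n hn => ?_
      have h : eU * toU y = toU ⁅(⟨1, 0, 0, 0, 0, 0⟩ : Sch), y⁆ + toU y * eU := by
        rw [LieHom.map_lie, LieRing.of_associative_ring_bracket]
        exact (sub_add_cancel _ _).symm
      change eU • (toU y • n) ∈ P
      rw [← mul_smul, h, add_smul, mul_smul]
      exact add_mem (Submodule.apply_mem_map₂ act Submodule.mem_top hn)
        (Submodule.apply_mem_map₂ act Submodule.mem_top (he n hn))
    exact hP hw

theorem finite_orbitSpan_add (a b : M) (ha : FiniteDimensional ℂ (orbitSpan a))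
    (hb : FiniteDimensional ℂ (orbitSpan b)) : FiniteDimensional ℂ (orbitSpan (a + b)) := by
  obtain ⟨N, hN, haN, heN⟩ := (finite_orbitSpan_iff a).1 ha
  obtain ⟨P, hP, hbP, heP⟩ := (finite_orbitSpan_iff b).1 hb
  refine (finite_orbitSpan_iff _).2 ⟨N ⊔ P, inferInstance,
    Submodule.add_mem_sup haN hbP, fun y hy => ?_⟩
  obtain ⟨c, hc, d, hd, rfl⟩ := Submodule.mem_sup.1 hy
  rw [smul_add]
  exact Submodule.add_mem_sup (heN c hc) (heP d hd)

theorem finite_orbitSpan_smul (u : U) : ∀ m : M, FiniteDimensional ℂ (orbitSpan m) →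
    FiniteDimensional ℂ (orbitSpan (u • m)) := by
  let S : Subalgebra ℂ U :=
    { carrier := {u | ∀ m : M, FiniteDimensional ℂ (orbitSpan m) →
        FiniteDimensional ℂ (orbitSpan (u • m))}
      mul_mem' := by
        intro a b ha hb m hm
        rw [mul_smul]
        exact ha _ (hb m hm)
      add_mem' := by
        intro a b ha hb m hm
        rw [add_smul]
        exact finite_orbitSpan_add M _ _ (ha m hm) (hb m hm)
      algebraMap_mem' := by
        intro c m hm
        obtain ⟨N, hN, hmN, heN⟩ := (finite_orbitSpan_iff m).1 hm
        rw [algebraMap_smul]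
        exact (finite_orbitSpan_iff _).2 ⟨N, hN, N.smul_mem c hmN, heN⟩ }
  have hS : S = ⊤ := subalgebra_eq_top S fun x m hm => finite_orbitSpan_toU_smul M x m hm
  have : u ∈ S := hS ▸ Algebra.mem_top
  exact this

/-- The `U`-submodule of all `m ∈ M` on which `e` acts locally finitely, that is
`dim ℂ[e] m < ∞`. -/
def locallyFinite : Submodule U M where
  carrier := {m | FiniteDimensional ℂ (orbitSpan m)}
  add_mem' := fun {a b} ha hb => finite_orbitSpan_add M a b ha hb
  zero_mem' := (finite_orbitSpan_iff _).2 ⟨⊥, inferInstance, rfl, fun y hy => by simp_all⟩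
  smul_mem' := fun u m hm => finite_orbitSpan_smul M u m hm

/-- The completion `EnAr(M)`: the submodule of `S_f ⊗_U M` on which `e` acts locally finitely. -/
abbrev EnAr : Type _ := locallyFinite (BalancedTensor U U Sf M)

end Completion

/-- The module `V(n, l₂)`: the completion of `Δ(n - 1, l₂)` if `n ≥ 0`, and of `Δ(n - 2, l₂)` if
`n < 0`. -/
abbrev V (n : ℤ) (l₂ : ℂ) : Type := EnAr (Verma (if 0 ≤ n then n - 1 else n - 2) l₂)

/-- A left ideal of the enveloping algebra is centrally generated if it is generated by
its intersection with the center `Z`. -/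
def IsCentrallyGenerated (I : Ideal U) : Prop :=
  I = Ideal.span ((I : Set U) ∩ (Subalgebra.center ℂ U : Set U))

end

end Schroedinger

namespace Schroedinger

attribute [local instance] LieRing.ofAssociativeRing

open Polynomial

/-! ## Representations of `sl₂` with a non-integral central character -/

section EndNontrivial

variable {N : Type*} [AddCommGroup N] [Module ℂ N]

/-! When `z` acts by a nonzero scalar `l`, the elements `p, q` form a Weyl pair, and quadratic
corrections in `p, q` turn `e, f, h` into an `sl₂`-triple commuting with that pair
(`SchRel.weylSlTwo`). Modulo `z - l` and `C - l c`, where `C` is the cubic central element `casU`,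
the enveloping algebra is therefore generated by a Weyl pair and a commuting `sl₂`-triple whose
Casimir element is the scalar `c + 5/4`.

If this scalar is not of the form `k² + 2k` with `k` natural, every nonzero representation of such
an algebra is faithful (`WeylSlTwo.injective_of_nontrivial`). The kernel is a two-sided ideal.
Commutators with `P`, `Q` and `H`, followed by multiplication by a root vector, reduce any of its
elements to polynomials in `H`. A nonzero polynomial in `H` cannot act by zero, because a weight
string would then have to end at both sides (`aeval_ne_zero_of_casimir`). Hence every nonzero module
with the given central character has annihilator exactly `centralIdeal l c`
(`annihilator_eq_centralIdeal`), which is centrally generated by construction.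

It remains to compare central characters and to see that the modules are nonzero. On a Verma module
`C` acts by `l₂ (l₁² + 3 l₁)`, which is invariant under `l₁ ↦ -3 - l₁`; this exchanges `n - 1` and
`-n - 2`. The shifted Casimir value is that of a half-integral `sl₂`-weight, so a parity argument
gives the hypothesis (`half_integral_ne`). Central scalars pass through `S_f ⊗ -`
(`smul_tensor_eq_of_mem_center`). The completion is nonzero because it contains an explicit vector
killed by `e` (`eU_smul_extVec`). That this vector and the Verma modules are nonzero is read off
from a representation on functions on `ℤ × ℤ`, in which `f` is invertible (`Coeffs.schRel`,
`tensorToCoeff`). -/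

theorem exists_eigenvector_of_aeval_apply_eq_zero (T : Module.End ℂ N) (d : ℕ) :
    ∀ G : ℂ[X], G.natDegree ≤ d → G ≠ 0 → ∀ x : N, x ≠ 0 → aeval T G x = 0 →
      ∃ (r : ℂ) (y : N), y ≠ 0 ∧ T y = r • y := by
  induction d with
  | zero =>
    intro G hd hG x hx h
    rw [eq_C_of_natDegree_le_zero hd, aeval_C, Module.algebraMap_end_apply] at h
    rcases smul_eq_zero.1 h with h | h
    · refine absurd ?_ hG
      rw [eq_C_of_natDegree_le_zero hd, h, C_0]
    · exact absurd h hx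
  | succ d ih =>
    intro G hd hG x hx h
    by_cases h0 : G.natDegree = 0
    · exact ih G (by omega) hG x hx h
    obtain ⟨r, hr⟩ := IsAlgClosed.exists_root G (fun h => h0 (natDegree_eq_of_degree_eq_some h))
    obtain ⟨G', rfl⟩ := dvd_iff_isRoot.2 hr
    have hG' : G' ≠ 0 := right_ne_zero_of_mul hG
    rw [natDegree_mul (X_sub_C_ne_zero r) hG', natDegree_X_sub_C] at hd
    -- Peel off one linear factor: either the cofactor already kills `x`, or its value at `x` is an
    -- eigenvector.
    by_cases hy : aeval T G' x = 0
    · exact ih G' (by omega) hG' x hx hy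
    · refine ⟨r, _, hy, ?_⟩
      rw [map_mul, Module.End.mul_apply, map_sub, aeval_X, aeval_C, LinearMap.sub_apply,
        Module.algebraMap_end_apply, sub_eq_zero] at h
      exact h

theorem aeval_apply_eigenvector (T : Module.End ℂ N) (G : ℂ[X]) {r : ℂ} {y : N}
    (h : T y = r • y) : aeval T G y = G.eval r • y := by
  induction G using Polynomial.induction_on' with
  | add p q hp hq => rw [map_add, LinearMap.add_apply, hp, hq, eval_add, add_smul]
  | monomial k a =>
    rw [aeval_monomial, Module.End.mul_apply, Module.algebraMap_end_apply, eval_monomial,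
      mul_smul]
    congr 1
    induction k with
    | zero => simp
    | succ k ih =>
      rw [pow_succ', Module.End.mul_apply, ih, map_smul, h, smul_smul, pow_succ]

/-- A nonzero polynomial does not vanish at the members of an arithmetic progression. -/
theorem exists_eval_arith_ne_zero {G : ℂ[X]} (hG : G ≠ 0) {a b : ℂ} (hb : b ≠ 0) :
    ∃ k : ℕ, G.eval (a + k * b) ≠ 0 := by
  by_contra! h
  refine hG (eq_zero_of_infinite_isRoot G ?_)
  refine (Set.infinite_range_of_injective (f := fun k : ℕ => a + k * b) ?_).mono ?_
  · intro k l hkl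
    have : (k : ℂ) * b = l * b := by simpa using hkl
    exact_mod_cast mul_right_cancel₀ hb this
  · rintro _ ⟨k, rfl⟩
    exact h k

/-- A relation `G(H) = 0` would leave only finitely many eigenvalues of `H`, and at least one.
Raising by `E` must then stop at a vector of some weight `m`, and the Casimir element forces `m² +
2m = c`. Lowering by `F` could stop only if `m` were a natural number, which is excluded, so the
weights `m - 2k` are infinitely many eigenvalues. -/
theorem aeval_ne_zero_of_casimir [Nontrivial N] (E F H : Module.End ℂ N) {c : ℂ}
    (hHE : H * E = E * H + (2 : ℂ) • E) (hHF : H * F = F * H - (2 : ℂ) • F)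
    (hEF : E * F = F * E + H)
    (hc : H * H + (2 : ℂ) • H + (4 : ℂ) • (F * E) = c • 1)
    (hck : ∀ k : ℕ, (k : ℂ) ^ 2 + 2 * k ≠ c) {G : ℂ[X]} (hG : G ≠ 0) : aeval H G ≠ 0 := by
  intro h
  have hev : ∀ (r : ℂ) (y : N), y ≠ 0 → H y = r • y → G.eval r = 0 := fun r y hy hr => by
    have := aeval_apply_eigenvector H G hr
    rw [h, LinearMap.zero_apply] at this
    exact (smul_eq_zero.1 this.symm).resolve_right hy
  have hHE' : ∀ x, H (E x) = E (H x) + (2 : ℂ) • E x := fun x => LinearMap.congr_fun hHE x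
  have hHF' : ∀ x, H (F x) = F (H x) - (2 : ℂ) • F x := fun x => LinearMap.congr_fun hHF x
  have hEF' : ∀ x, E (F x) = F (E x) + H x := fun x => LinearMap.congr_fun hEF x
  have hc' : ∀ x, H (H x) + (2 : ℂ) • H x + (4 : ℂ) • F (E x) = c • x :=
    fun x => LinearMap.congr_fun hc x
  obtain ⟨x, hx⟩ := exists_ne (0 : N)
  obtain ⟨r, y, hy, hry⟩ := exists_eigenvector_of_aeval_apply_eq_zero H _ G le_rfl hG x hx
    (by rw [h, LinearMap.zero_apply])
  have hE : ∀ k : ℕ, H ((E ^ k) y) = (r + k * 2) • (E ^ k) y := by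
    intro k
    induction k with
    | zero => simpa using hry
    | succ k ih =>
      rw [pow_succ', Module.End.mul_apply, hHE', ih, map_smul]
      push_cast
      module
  have hex : ∃ k : ℕ, (E ^ k) y ≠ 0 ∧ E ((E ^ k) y) = 0 := by
    by_contra! hcon
    have hne : ∀ k : ℕ, (E ^ k) y ≠ 0 := by
      intro k
      induction k with
      | zero => simpa using hy
      | succ k ih => rw [pow_succ', Module.End.mul_apply]; exact hcon k ih
    obtain ⟨k, hk⟩ := exists_eval_arith_ne_zero hG (a := r) (b := 2) two_ne_zero
    exact hk (hev _ _ (hne k) (hE k))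
  obtain ⟨k, hwne, hEw⟩ := hex
  have hw := hE k
  generalize (E ^ k) y = w at hwne hEw hw
  generalize r + k * 2 = m at hw
  have hm : m ^ 2 + 2 * m = c := by
    have h1 := hc' w
    rw [hEw, map_zero, smul_zero, add_zero, hw, map_smul, hw, smul_smul, smul_smul, ← add_smul,
      ← sub_eq_zero, ← sub_smul] at h1
    have := (smul_eq_zero.1 h1).resolve_right hwne
    linear_combination this
  have hF : ∀ k : ℕ, H ((F ^ k) w) = (m + k * (-2)) • (F ^ k) w := by
    intro k
    induction k with
    | zero => simpa using hw
    | succ k ih =>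
      rw [pow_succ', Module.End.mul_apply, hHF', ih, map_smul]
      push_cast
      module
  have hEFk : ∀ k : ℕ, E ((F ^ (k + 1)) w) = ((k + 1) * (m - k)) • (F ^ k) w := by
    intro k
    induction k with
    | zero => simp [hEF', hEw, hw]
    | succ k ih =>
      rw [pow_succ', Module.End.mul_apply, hEF', ih, hF, map_smul, ← Module.End.mul_apply,
        ← pow_succ']
      push_cast
      module
  have hne : ∀ k : ℕ, (F ^ k) w ≠ 0 := by
    intro k
    induction k with
    | zero => simpa using hwne
    | succ k ih =>
      intro h0
      have h1 := hEFk k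
      rw [h0, map_zero] at h1
      have h2 := (smul_eq_zero.1 h1.symm).resolve_right ih
      have h3 : m - k = 0 := (mul_eq_zero.1 h2).resolve_left (Nat.cast_add_one_ne_zero k)
      exact hck k (by rw [← sub_eq_zero.1 h3]; exact hm)
  obtain ⟨k, hk⟩ := exists_eval_arith_ne_zero hG (a := m) (b := -2) (by norm_num)
  exact hk (hev _ _ (hne k) (hF k))

end EndNontrivial

/-! ## The tensor product of a Weyl algebra and a central quotient of `U(sl₂)` -/

/-- Elements of a complex algebra that satisfy the relations of an `sl₂`-triple with Casimir
element `c`, and of a commuting Weyl pair with `[P, Q] = l`. -/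
structure WeylSlTwo (A : Type*) [Ring A] [Algebra ℂ A] (l c : ℂ) where
  (E F H P Q : A)
  hHE : H * E = E * H + (2 : ℂ) • E
  hHF : H * F = F * H - (2 : ℂ) • F
  hEF : E * F = F * E + H
  hcas : H * H + (2 : ℂ) • H + (4 : ℂ) • (F * E) = c • 1
  hPQ : P * Q = Q * P + l • 1
  hPE : Commute P E
  hPF : Commute P F
  hPH : Commute P H
  hQE : Commute Q E
  hQF : Commute Q F
  hQH : Commute Q H

namespace WeylSlTwo

variable {A : Type*} [Ring A] [Algebra ℂ A] {l c : ℂ} (D : WeylSlTwo A l c)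

/-- The polynomial that expresses `F * E` in terms of `H`. -/
noncomputable def casPoly (c : ℂ) : ℂ[X] := C (1 / 4) * (C c - X ^ 2 - C 2 * X)

theorem casPoly_ne_zero (c : ℂ) : casPoly c ≠ 0 := by
  intro h
  have h0 := congrArg (eval 0) h
  have h1 := congrArg (eval 1) h
  simp [casPoly] at h0 h1
  subst h0
  norm_num at h1

theorem casPoly_add_X_ne_zero (c : ℂ) : casPoly c + X ≠ 0 := by
  intro h
  have h0 := congrArg (eval 0) h
  have h1 := congrArg (eval 1) h
  simp [casPoly] at h0 h1
  subst h0
  norm_num at h1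

theorem F_mul_E : D.F * D.E = aeval D.H (casPoly c) := by
  have h := D.hcas
  have h4 : (4 : ℂ) • (D.F * D.E) = c • 1 - D.H * D.H - (2 : ℂ) • D.H := by
    rw [← h]; abel
  have : D.F * D.E = (1 / 4 : ℂ) • ((4 : ℂ) • (D.F * D.E)) := by
    rw [smul_smul]; norm_num
  rw [this, h4]
  simp [casPoly, Algebra.algebraMap_eq_smul_one, pow_two]

theorem E_mul_F : D.E * D.F = aeval D.H (casPoly c + X) := by
  rw [D.hEF, D.F_mul_E, map_add, aeval_X]

/-- Passing an element of weight `a` shifts the argument of a polynomial in `H` by `a`. This is used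
for the powers of both `E` and `F`. -/
theorem aeval_mul_E (g : ℂ[X]) (a : ℂ) (Y : A) (hY : D.H * Y = Y * D.H + a • Y) :
    aeval D.H g * Y = Y * aeval D.H (g.comp (X + C a)) := by
  have h1 : D.H * Y = Y * (aeval D.H (X + C a)) := by
    rw [hY, map_add, aeval_X, aeval_C, mul_add, Algebra.algebraMap_eq_smul_one, mul_smul_comm,
      mul_one]
  induction g using Polynomial.induction_on' with
  | add p q hp hq => rw [map_add, add_mul, hp, hq, add_comp, map_add, mul_add]
  | monomial k b =>
    rw [← C_mul_X_pow_eq_monomial, mul_comp, C_comp, X_pow_comp, map_mul, map_mul, aeval_C,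
      ← mul_assoc, ← Algebra.commutes, mul_assoc, mul_assoc, map_pow, aeval_X, map_pow]
    congr 1
    induction k with
    | zero => simp
    | succ k ih =>
      rw [pow_succ', mul_assoc, ih, ← mul_assoc, h1, mul_assoc, ← pow_succ']

theorem H_mul_E_pow (k : ℕ) : D.H * D.E ^ k = D.E ^ k * D.H + (2 * k : ℂ) • D.E ^ k := by
  induction k with
  | zero => simp
  | succ k ih =>
    rw [pow_succ, ← mul_assoc, ih, add_mul, mul_assoc, D.hHE, mul_add, ← mul_assoc,
      mul_smul_comm, smul_mul_assoc, add_assoc, ← add_smul]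
    congr 2
    push_cast; ring

theorem H_mul_F_pow (k : ℕ) : D.H * D.F ^ k = D.F ^ k * D.H + (-2 * k : ℂ) • D.F ^ k := by
  induction k with
  | zero => simp
  | succ k ih =>
    rw [pow_succ, ← mul_assoc, ih, add_mul, mul_assoc, D.hHF, mul_sub, ← mul_assoc,
      mul_smul_comm, smul_mul_assoc, sub_eq_add_neg, ← neg_smul, add_assoc, ← add_smul]
    congr 2
    push_cast; ring

/-! ### Weight spaces of the `sl₂`-part -/

/-- The power of `E` or `F` of weight `2 k`. -/
def root (k : ℤ) : A := if 0 ≤ k then D.E ^ k.toNat else D.F ^ (-k).toNat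

theorem root_natCast (k : ℕ) : D.root k = D.E ^ k := by simp [root]

theorem root_neg_natCast (k : ℕ) : D.root (-k) = D.F ^ k := by
  rcases k with _ | k
  · simp [root]
  · rw [root, if_neg (by omega), neg_neg, Int.toNat_natCast]

theorem H_mul_root (k : ℤ) : D.H * D.root k = D.root k * D.H + (2 * k : ℂ) • D.root k := by
  obtain ⟨k, rfl | rfl⟩ := k.eq_nat_or_neg
  · rw [root_natCast, H_mul_E_pow]; simp
  · rw [root_neg_natCast, H_mul_F_pow]; simp

/-- The elements of weight `2 k` of the algebra generated by `E, F, H`. -/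
noncomputable def weightSpace (k : ℤ) : Submodule ℂ A :=
  LinearMap.range ((LinearMap.mulLeft ℂ (D.root k)).comp (aeval D.H).toLinearMap)

theorem mem_weightSpace {k : ℤ} {x : A} :
    x ∈ D.weightSpace k ↔ ∃ g : ℂ[X], D.root k * aeval D.H g = x := Iff.rfl

/-- The algebra generated by `E, F, H`, as the sum of its weight spaces. -/
noncomputable def slSpan : Submodule ℂ A := ⨆ k, D.weightSpace k

theorem weightSpace_le_slSpan (k : ℤ) : D.weightSpace k ≤ D.slSpan := le_iSup _ k

theorem one_mem_slSpan : (1 : A) ∈ D.slSpan :=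
  D.weightSpace_le_slSpan 0 ⟨1, by simp [root]⟩

theorem mul_mem_slSpan (Y : A) (h : ∀ (k : ℤ) (g : ℂ[X]), Y * (D.root k * aeval D.H g) ∈ D.slSpan)
    {x : A} (hx : x ∈ D.slSpan) : Y * x ∈ D.slSpan := by
  have : D.slSpan ≤ D.slSpan.comap (LinearMap.mulLeft ℂ Y) := by
    refine iSup_le fun k => ?_
    rintro _ ⟨g, rfl⟩
    exact h k g
  exact this hx

theorem root_mul_mem (k : ℤ) (g : ℂ[X]) : D.root k * aeval D.H g ∈ D.slSpan :=
  D.weightSpace_le_slSpan k ⟨g, rfl⟩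

theorem H_mul_mem {x : A} (hx : x ∈ D.slSpan) : D.H * x ∈ D.slSpan := by
  refine D.mul_mem_slSpan _ (fun k g => ?_) hx
  rw [← mul_assoc, H_mul_root, add_mul, mul_assoc, smul_mul_assoc]
  refine add_mem ?_ (Submodule.smul_mem _ _ (D.root_mul_mem k g))
  have := D.root_mul_mem k (X * g)
  rwa [map_mul, aeval_X] at this

/-- When `E` meets a positive power of `F`, one product `E F` becomes a polynomial in `H`, and
moving it to the right only shifts its argument. In the other cases the power of `E` goes up by one.
-/
theorem E_mul_mem {x : A} (hx : x ∈ D.slSpan) : D.E * x ∈ D.slSpan := by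
  refine D.mul_mem_slSpan _ (fun k g => ?_) hx
  obtain ⟨k, rfl | rfl⟩ := k.eq_nat_or_neg
  · have := D.root_mul_mem ((k + 1 : ℕ) : ℤ) g
    rwa [root_natCast, pow_succ', mul_assoc, ← D.root_natCast] at this
  · rcases k with _ | k
    · have := D.root_mul_mem ((1 : ℕ) : ℤ) g
      rw [root_natCast, pow_one] at this
      simpa [root] using this
    · have := D.root_mul_mem (-(k : ℤ)) ((casPoly c + X).comp (X + C (-2 * (k : ℂ))) * g)
      rw [root_neg_natCast, pow_succ', ← mul_assoc, ← mul_assoc, E_mul_F,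
        D.aeval_mul_E _ _ _ (D.H_mul_F_pow k), mul_assoc, ← map_mul, ← root_neg_natCast]
      exact this

theorem F_mul_mem {x : A} (hx : x ∈ D.slSpan) : D.F * x ∈ D.slSpan := by
  refine D.mul_mem_slSpan _ (fun k g => ?_) hx
  obtain ⟨k, rfl | rfl⟩ := k.eq_nat_or_neg
  · rcases k with _ | k
    · have := D.root_mul_mem (-((1 : ℕ) : ℤ)) g
      rw [root_neg_natCast, pow_one] at this
      simpa [root] using this
    · have := D.root_mul_mem (k : ℤ) ((casPoly c).comp (X + C (2 * (k : ℂ))) * g)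
      rw [root_natCast, pow_succ', ← mul_assoc, ← mul_assoc, F_mul_E,
        D.aeval_mul_E _ _ _ (D.H_mul_E_pow k), mul_assoc, ← map_mul, ← root_natCast]
      exact this
  · have := D.root_mul_mem (-((k + 1 : ℕ) : ℤ)) g
    rwa [root_neg_natCast, pow_succ', mul_assoc, ← D.root_neg_natCast] at this

/-- The product of the root vectors of opposite weights is a nonzero polynomial in `H`. -/
theorem exists_root_neg_mul_root (k : ℤ) :
    ∃ R : ℂ[X], R ≠ 0 ∧ D.root (-k) * D.root k = aeval D.H R := by
  have hcomp : ∀ (R : ℂ[X]) (a : ℂ), R ≠ 0 → R.comp (X + C a) ≠ 0 := fun R a hR h =>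
    hR (comp_X_add_C_eq_zero_iff.1 h)
  obtain ⟨k, rfl | rfl⟩ := k.eq_nat_or_neg
  · rw [root_natCast, root_neg_natCast]
    induction k with
    | zero => exact ⟨1, one_ne_zero, by simp⟩
    | succ k ih =>
      obtain ⟨R, hR, h⟩ := ih
      refine ⟨R * (casPoly c).comp (X + C (2 * (k : ℂ))),
        mul_ne_zero hR (hcomp _ _ (casPoly_ne_zero c)), ?_⟩
      rw [pow_succ, pow_succ', mul_assoc, ← mul_assoc D.F, F_mul_E,
        D.aeval_mul_E _ _ _ (D.H_mul_E_pow k), ← mul_assoc, h, map_mul (aeval D.H) R]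
  · rw [neg_neg, root_natCast, root_neg_natCast]
    induction k with
    | zero => exact ⟨1, one_ne_zero, by simp⟩
    | succ k ih =>
      obtain ⟨R, hR, h⟩ := ih
      refine ⟨R * (casPoly c + X).comp (X + C (-2 * (k : ℂ))),
        mul_ne_zero hR (hcomp _ _ (casPoly_add_X_ne_zero c)), ?_⟩
      rw [pow_succ, pow_succ', mul_assoc, ← mul_assoc D.E, E_mul_F,
        D.aeval_mul_E _ _ _ (D.H_mul_F_pow k), ← mul_assoc, h, map_mul (aeval D.H) R]

/-! ### Extracting components -/

/-- Separation of eigenvalues: `ad T - 2 k₀` removes the term of index `k₀` and multiplies each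
other term by the nonzero scalar `2 (k - k₀)`, which allows induction on the number of terms. -/
theorem mem_of_sum_mem_of_ad_eigen (K : Submodule ℂ A) (T : A)
    (hK : ∀ x ∈ K, T * x - x * T ∈ K) (s : Finset ℤ) :
    ∀ x : ℤ → A, (∀ k, T * x k - x k * T = (2 * k : ℂ) • x k) → ∑ k ∈ s, x k ∈ K →
      ∀ k ∈ s, x k ∈ K := by
  induction s using Finset.induction_on with
  | empty => simp
  | insert k₀ s hk₀ ih =>
    intro x hx hsum
    have h1 : ∑ k ∈ s, (2 * (k : ℂ) - 2 * k₀) • x k ∈ K := by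
      have h := sub_mem (hK _ hsum) (K.smul_mem (2 * k₀ : ℂ) hsum)
      rw [Finset.mul_sum, Finset.sum_mul, ← Finset.sum_sub_distrib, Finset.smul_sum,
        ← Finset.sum_sub_distrib, Finset.sum_insert hk₀] at h
      simp only [hx, ← sub_smul, sub_self, zero_add] at h
      exact h
    have h2 : ∀ k ∈ s, x k ∈ K := by
      intro k hk
      have := ih (fun k => (2 * (k : ℂ) - 2 * k₀) • x k) (fun k => by
        rw [mul_smul_comm, smul_mul_assoc, ← smul_sub, hx, smul_comm]) h1 k hk
      refine (Submodule.smul_mem_iff K ?_).1 this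
      rw [← mul_sub]
      refine mul_ne_zero two_ne_zero (sub_ne_zero.2 ?_)
      exact_mod_cast fun h : k = k₀ => hk₀ (h ▸ hk)
    intro k hk
    rcases Finset.mem_insert.1 hk with rfl | hk
    · rw [Finset.sum_insert hk₀] at hsum
      exact (Submodule.add_mem_iff_left K (sum_mem h2)).1 hsum
    · exact h2 k hk

theorem mul_pow_succ_of_weyl {T Y : A} {a : ℂ} (hTY : T * Y = Y * T + a • 1) (j : ℕ) :
    T * Y ^ (j + 1) = Y ^ (j + 1) * T + (a * (j + 1)) • Y ^ j := by
  induction j with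
  | zero => simp [hTY]
  | succ j ih =>
    rw [pow_succ _ (j + 1), ← mul_assoc, ih, add_mul, mul_assoc, hTY, mul_add, ← mul_assoc,
      mul_smul_comm, smul_mul_assoc, mul_one, ← pow_succ Y j, add_assoc, ← add_smul]
    congr 2
    push_cast; ring

/-- On polynomials in `Y` whose coefficients commute with `T`, `ad T` is `a · d/dY`. Differentiation
lowers the degree and multiplies the coefficients by nonzero integers, so induction gives all
coefficients except the constant one, which is then obtained by subtraction. -/
theorem mem_of_sum_pow_mul_mem (K : Submodule ℂ A) {T Y : A} {a : ℂ} (ha : a ≠ 0)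
    (hTY : T * Y = Y * T + a • 1) (hK : ∀ x ∈ K, T * x - x * T ∈ K) (hKY : ∀ x ∈ K, Y * x ∈ K)
    (m : ℕ) : ∀ s : ℕ → A, (∀ j, Commute T (s j)) → ∑ j ∈ Finset.range m, Y ^ j * s j ∈ K →
      ∀ j < m, s j ∈ K := by
  induction m with
  | zero => simp
  | succ m ih =>
    intro s hs hsum
    have hd : ∀ j, T * (Y ^ (j + 1) * s (j + 1)) - Y ^ (j + 1) * s (j + 1) * T =
        a • (Y ^ j * (((j : ℂ) + 1) • s (j + 1))) := by
      intro j
      rw [← mul_assoc, mul_pow_succ_of_weyl hTY, add_mul, mul_assoc, mul_assoc, (hs (j + 1)).eq, add_sub_cancel_left,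
        mul_smul_comm, smul_mul_assoc, smul_smul]
    have h1 : ∑ j ∈ Finset.range m, Y ^ j * (((j : ℂ) + 1) • s (j + 1)) ∈ K := by
      have h := hK _ hsum
      rw [Finset.sum_range_succ', mul_add, add_mul, Finset.mul_sum, Finset.sum_mul,
        add_sub_add_comm, ← Finset.sum_sub_distrib, pow_zero, one_mul, (hs 0).eq, sub_self,
        add_zero] at h
      simp only [hd] at h
      rw [← Finset.smul_sum] at h
      exact (Submodule.smul_mem_iff K ha).1 h
    have h2 : ∀ j < m, s (j + 1) ∈ K := fun j hj =>
      (Submodule.smul_mem_iff K (Nat.cast_add_one_ne_zero j)).1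
        (ih (fun j => ((j : ℂ) + 1) • s (j + 1)) (fun j => (hs (j + 1)).smul_right _) h1 j hj)
    intro j hj
    rcases j with _ | j
    · have hKp : ∀ (k : ℕ) (x : A), x ∈ K → Y ^ k * x ∈ K := by
        intro k
        induction k with
        | zero => simp
        | succ k ihk => intro x hx; rw [pow_succ, mul_assoc]; exact ihk _ (hKY x hx)
      rw [Finset.sum_range_succ', pow_zero, one_mul] at hsum
      exact (Submodule.add_mem_iff_right K (sum_mem fun j hj =>
        hKp _ _ (h2 j (Finset.mem_range.1 hj)))).1 hsum
    · exact h2 j (by omega)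

/-! ### Ordered products and faithfulness of representations -/

/-- The span of the products `Y ^ j * s` with `s ∈ S`. -/
def powSpan (Y : A) (S : Submodule ℂ A) : Submodule ℂ A :=
  ⨆ j : ℕ, S.map (LinearMap.mulLeft ℂ (Y ^ j))

theorem pow_mul_mem_powSpan (Y : A) {S : Submodule ℂ A} (j : ℕ) {s : A} (hs : s ∈ S) :
    Y ^ j * s ∈ powSpan Y S :=
  Submodule.mem_iSup_of_mem j ⟨s, hs, rfl⟩

theorem mul_mem_powSpan {Y T : A} {S S' : Submodule ℂ A}
    (h : ∀ (j : ℕ), ∀ s ∈ S, T * (Y ^ j * s) ∈ powSpan Y S') {x : A} (hx : x ∈ powSpan Y S) :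
    T * x ∈ powSpan Y S' := by
  have : powSpan Y S ≤ (powSpan Y S').comap (LinearMap.mulLeft ℂ T) := by
    refine iSup_le fun j => ?_
    rintro _ ⟨s, hs, rfl⟩
    exact h j s hs
  exact this hx

theorem mul_mem_powSpan_self (Y : A) {S : Submodule ℂ A} {x : A} (hx : x ∈ powSpan Y S) :
    Y * x ∈ powSpan Y S :=
  mul_mem_powSpan (fun j s hs => by
    rw [← mul_assoc, ← pow_succ']; exact pow_mul_mem_powSpan Y _ hs) hx

theorem mul_mem_powSpan_of_commute {Y T : A} {S : Submodule ℂ A} (hT : Commute T Y)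
    (h : ∀ s ∈ S, T * s ∈ S) {x : A} (hx : x ∈ powSpan Y S) : T * x ∈ powSpan Y S :=
  mul_mem_powSpan (fun j s hs => by
    rw [← mul_assoc, (hT.pow_right j).eq, mul_assoc]
    exact pow_mul_mem_powSpan Y _ (h s hs)) hx

/-- This adjoins one Weyl variable to the statement that `K` meets `S` trivially. It is applied
twice, for powers of `P` using `ad Q`, and then for powers of `Q` using `ad P`. -/
theorem eq_zero_of_mem_powSpan (K : Submodule ℂ A) {T Y : A} {a : ℂ} (ha : a ≠ 0)
    (hTY : T * Y = Y * T + a • 1) (hK : ∀ x ∈ K, T * x - x * T ∈ K) (hKY : ∀ x ∈ K, Y * x ∈ K)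
    {S : Submodule ℂ A} (hTS : ∀ s ∈ S, Commute T s) (hS : ∀ s ∈ S, s ∈ K → s = 0)
    {x : A} (hx : x ∈ powSpan Y S) (hxK : x ∈ K) : x = 0 := by
  obtain ⟨f, hf, rfl⟩ := (Submodule.mem_iSup_iff_exists_finsupp _ _).1 hx
  choose s hsS hs using hf
  obtain ⟨m, hm⟩ : ∃ m, f.support ⊆ Finset.range m := by
    obtain ⟨m, hm⟩ := f.support.exists_nat_subset_range
    exact ⟨m, hm⟩
  have hsum : (f.sum fun _ y => y) = ∑ j ∈ Finset.range m, Y ^ j * s j := by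
    rw [Finsupp.sum_of_support_subset f hm _ (by simp)]
    exact Finset.sum_congr rfl fun j _ => (hs j).symm
  rw [hsum] at hxK ⊢
  have h := mem_of_sum_pow_mul_mem K ha hTY hK hKY m s (fun j => hTS _ (hsS j)) hxK
  refine Finset.sum_eq_zero fun j hj => ?_
  rw [hS _ (hsS j) (h j (Finset.mem_range.1 hj)), mul_zero]

/-- If the five elements generate the algebra, it is spanned by the normally ordered products. -/
theorem powSpan_powSpan_eq_top (hgen : Algebra.adjoin ℂ {D.E, D.F, D.H, D.P, D.Q} = ⊤) :
    powSpan D.Q (powSpan D.P D.slSpan) = ⊤ := by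
  set S := powSpan D.Q (powSpan D.P D.slSpan) with hSdef
  have h1 : (1 : A) ∈ S := by
    have := pow_mul_mem_powSpan D.Q 0 (pow_mul_mem_powSpan D.P 0 D.one_mem_slSpan)
    simpa using this
  have hmul : ∀ y ∈ ({D.E, D.F, D.H, D.P, D.Q} : Set A), ∀ x ∈ S, y * x ∈ S := by
    intro y hy x hx
    rcases hy with rfl | rfl | rfl | rfl | rfl
    · exact mul_mem_powSpan_of_commute D.hQE.symm
        (fun s hs => mul_mem_powSpan_of_commute D.hPE.symm (fun _ => D.E_mul_mem) hs) hx
    · exact mul_mem_powSpan_of_commute D.hQF.symm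
        (fun s hs => mul_mem_powSpan_of_commute D.hPF.symm (fun _ => D.F_mul_mem) hs) hx
    · exact mul_mem_powSpan_of_commute D.hQH.symm
        (fun s hs => mul_mem_powSpan_of_commute D.hPH.symm (fun _ => D.H_mul_mem) hs) hx
    · refine mul_mem_powSpan (fun j s hs => ?_) hx
      rcases j with _ | j
      · rw [pow_zero, one_mul]
        have := pow_mul_mem_powSpan D.Q 0 (mul_mem_powSpan_self D.P hs)
        simpa using this
      · rw [← mul_assoc, mul_pow_succ_of_weyl D.hPQ, add_mul, mul_assoc, smul_mul_assoc]
        exact add_mem (pow_mul_mem_powSpan _ _ (mul_mem_powSpan_self D.P hs))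
          (Submodule.smul_mem _ _ (pow_mul_mem_powSpan _ _ hs))
    · exact mul_mem_powSpan_self D.Q hx
  have hall : ∀ y : A, ∀ x ∈ S, y * x ∈ S := by
    intro y
    have hy : y ∈ Algebra.adjoin ℂ {D.E, D.F, D.H, D.P, D.Q} := hgen ▸ Algebra.mem_top
    induction hy using Algebra.adjoin_induction with
    | mem y hy => exact hmul y hy
    | algebraMap r =>
      intro x hx
      rw [← Algebra.smul_def]; exact S.smul_mem r hx
    | add a b _ _ ha hb => intro x hx; rw [add_mul]; exact add_mem (ha x hx) (hb x hx)
    | mul a b _ _ ha hb => intro x hx; rw [mul_assoc]; exact ha _ (hb x hx)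
  refine eq_top_iff.2 fun y _ => ?_
  simpa using hall y 1 h1

/-- Every nonzero representation is faithful, if the central character is not that of a
finite-dimensional representation. -/
theorem injective_of_nontrivial (hl : l ≠ 0) (hck : ∀ k : ℕ, (k : ℂ) ^ 2 + 2 * k ≠ c)
    (hgen : Algebra.adjoin ℂ {D.E, D.F, D.H, D.P, D.Q} = ⊤)
    {N : Type*} [AddCommGroup N] [Module ℂ N] [Nontrivial N] (ρ : A →ₐ[ℂ] Module.End ℂ N) :
    Function.Injective ρ := by
  have hpoly : ∀ G : ℂ[X], ρ (aeval D.H G) = 0 → G = 0 := by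
    intro G hG
    by_contra hne
    refine aeval_ne_zero_of_casimir (ρ D.E) (ρ D.F) (ρ D.H) (c := c) ?_ ?_ ?_ ?_ hck hne ?_
    · simpa using congrArg ρ D.hHE
    · simpa using congrArg ρ D.hHF
    · simpa using congrArg ρ D.hEF
    · simpa using congrArg ρ D.hcas
    · rw [← hG, aeval_algHom_apply]
  let K : Submodule ℂ A := LinearMap.ker ρ.toLinearMap
  have hmem : ∀ x, x ∈ K ↔ ρ x = 0 := fun x => Iff.rfl
  have hKl : ∀ y, ∀ x ∈ K, y * x ∈ K := fun y x hx => by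
    rw [hmem] at hx ⊢
    rw [map_mul, hx, mul_zero]
  have hKad : ∀ y, ∀ x ∈ K, y * x - x * y ∈ K := fun y x hx => by
    refine sub_mem (hKl y x hx) ?_
    rw [hmem] at hx ⊢
    rw [map_mul, hx, zero_mul]
  have hsl : ∀ s ∈ D.slSpan, s ∈ K → s = 0 := by
    intro x hx hxK
    obtain ⟨f, hf, rfl⟩ := (Submodule.mem_iSup_iff_exists_finsupp _ _).1 hx
    have hw : ∀ k, D.H * f k - f k * D.H = (2 * k : ℂ) • f k := by
      intro k
      obtain ⟨g, hg⟩ := D.mem_weightSpace.1 (hf k)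
      have hcomm : aeval D.H g * D.H = D.H * aeval D.H g := by
        have h := congrArg (aeval D.H) (mul_comm g X)
        simpa only [map_mul, aeval_X] using h
      rw [← hg, ← mul_assoc, H_mul_root, mul_assoc (D.root k), hcomm, add_mul, mul_assoc,
        add_sub_cancel_left, smul_mul_assoc]
    have h := mem_of_sum_mem_of_ad_eigen K D.H (hKad D.H) f.support f hw hxK
    refine Finset.sum_eq_zero fun k hk => ?_
    obtain ⟨g, hg⟩ := D.mem_weightSpace.1 (hf k)
    -- Multiplying by the opposite root vector turns a weight component into the polynomial `R g` in
    -- `H`. It lies in the kernel, so `R g = 0`, and `g = 0` since `R ≠ 0`.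
    obtain ⟨R, hR, hRk⟩ := D.exists_root_neg_mul_root k
    have h1 := hKl (D.root (-k)) _ (h k hk)
    rw [← hg, ← mul_assoc, hRk, ← map_mul, hmem] at h1
    have h2 := (mul_eq_zero.1 (hpoly _ h1)).resolve_left hR
    rw [← hg, h2, map_zero, mul_zero]
  have hQP : D.Q * D.P = D.P * D.Q + (-l) • (1 : A) := by
    rw [D.hPQ, neg_smul, add_neg_cancel_right]
  have hcommSl : ∀ Y : A, Commute Y D.E → Commute Y D.F → Commute Y D.H →
      ∀ s ∈ D.slSpan, Commute Y s := by
    intro Y hE hF hH s hs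
    have hle : D.slSpan ≤ (Subalgebra.centralizer ℂ {Y}).toSubmodule := by
      refine iSup_le fun k => ?_
      rintro _ ⟨g, rfl⟩
      have hcen : ∀ y, Commute Y y → y ∈ Subalgebra.centralizer ℂ {Y} := fun y hy => by
        rw [Subalgebra.mem_centralizer_iff]
        rintro _ rfl
        exact hy
      refine Subalgebra.mul_mem _ ?_ ?_
      · rw [root]
        split_ifs
        · exact pow_mem (hcen _ hE) _
        · exact pow_mem (hcen _ hF) _
      · have : aeval D.H g ∈ Algebra.adjoin ℂ {D.H} := aeval_mem_adjoin_singleton ℂ D.H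
        exact Algebra.adjoin_le (by rintro _ rfl; exact hcen _ hH) this
    exact (Subalgebra.mem_centralizer_iff ℂ).1 (hle hs) Y rfl
  have hP : ∀ s ∈ powSpan D.P D.slSpan, s ∈ K → s = 0 := fun s hs hsK =>
    eq_zero_of_mem_powSpan K (neg_ne_zero.2 hl) hQP (hKad D.Q) (hKl D.P)
      (hcommSl D.Q D.hQE D.hQF D.hQH) hsl hs hsK
  have hcommP : ∀ s ∈ powSpan D.P D.slSpan, Commute D.P s := by
    intro s hs
    have hle : powSpan D.P D.slSpan ≤ (Subalgebra.centralizer ℂ {D.P}).toSubmodule := by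
      refine iSup_le fun j => ?_
      rintro _ ⟨g, hg, rfl⟩
      refine (Subalgebra.mem_centralizer_iff ℂ).2 ?_
      rintro _ rfl
      exact ((Commute.refl D.P).pow_right j).mul_right
        (hcommSl D.P D.hPE D.hPF D.hPH g hg)
    exact (Subalgebra.mem_centralizer_iff ℂ).1 (hle hs) D.P rfl
  refine (injective_iff_map_eq_zero ρ).2 fun x hx => ?_
  have hxtop : x ∈ powSpan D.Q (powSpan D.P D.slSpan) :=
    D.powSpan_powSpan_eq_top hgen ▸ Submodule.mem_top
  exact eq_zero_of_mem_powSpan K hl D.hPQ (hKad D.P) (hKl D.Q) hcommP hP hxtop hx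

end WeylSlTwo

noncomputable section

/-! ## The primitive quotients of the enveloping algebra -/

/-- The basis element `h`, in the enveloping algebra. -/
def hU : U := toU ⟨0, 1, 0, 0, 0, 0⟩

/-- The basis element `p`, in the enveloping algebra. -/
def pU : U := toU ⟨0, 0, 0, 1, 0, 0⟩

/-- The basis element `q`, in the enveloping algebra. -/
def qU : U := toU ⟨0, 0, 0, 0, 1, 0⟩

/-- The basis element `z`, in the enveloping algebra. -/
def zU : U := toU ⟨0, 0, 0, 0, 0, 1⟩

theorem toU_mul_toU (x y : Sch) : toU x * toU y = toU y * toU x + toU ⁅x, y⁆ := by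
  rw [LieHom.map_lie, LieRing.of_associative_ring_bracket, add_sub_cancel]

theorem toU_eq (x : Sch) :
    toU x = x.e • eU + x.h • hU + x.f • fU + x.p • pU + x.q • qU + x.z • zU := by
  have hx : x = x.e • (⟨1, 0, 0, 0, 0, 0⟩ : Sch) + x.h • (⟨0, 1, 0, 0, 0, 0⟩ : Sch) +
      x.f • (⟨0, 0, 1, 0, 0, 0⟩ : Sch) + x.p • (⟨0, 0, 0, 1, 0, 0⟩ : Sch) +
      x.q • (⟨0, 0, 0, 0, 1, 0⟩ : Sch) + x.z • (⟨0, 0, 0, 0, 0, 1⟩ : Sch) := by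
    ext <;> simp
  conv_lhs => rw [hx]
  simp only [map_add, map_smul]
  rfl

theorem toU_mul_toU_eq (x y : Sch) : toU x * toU y = toU y * toU x +
    (⁅x, y⁆.e • eU + ⁅x, y⁆.h • hU + ⁅x, y⁆.f • fU + ⁅x, y⁆.p • pU + ⁅x, y⁆.q • qU +
      ⁅x, y⁆.z • zU) := by
  rw [toU_mul_toU, toU_eq ⁅x, y⁆]

/-- The defining relations of the Schrödinger algebra, for elements of an associative ring. -/
structure SchRel {A : Type*} [Ring A] (e h f p q z : A) : Prop where
  hf : h * f = f * h - 2 • f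
  ef : e * f = f * e + h
  pf : p * f = f * p - q
  qf : q * f = f * q
  hq : h * q = q * h - q
  pq : p * q = q * p + z
  eq : e * q = q * e + p
  ph : p * h = h * p - p
  eh : e * h = h * e - 2 • e
  ep : e * p = p * e
  fz : f * z = z * f
  qz : q * z = z * q
  hz : h * z = z * h
  pz : p * z = z * p
  ez : e * z = z * e

theorem schRel_U : SchRel eU hU fU pU qU zU := by
  constructor <;>
  · refine (toU_mul_toU_eq _ _).trans ?_
    simp only [eU, hU, fU, pU, qU, zU, Sch.lie_e, Sch.lie_h, Sch.lie_f, Sch.lie_p, Sch.lie_q,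
      Sch.lie_z]
    module

/-! ### The cubic Casimir element and the splitting off of the Weyl pair -/

/-- The cubic central element. -/
def cubicCasimir {A : Type*} [Ring A] (e h f p q z : A) : A :=
  z * (h * h + 3 • h + 4 • (f * e)) + (2 • (h * (q * p)) + 4 • (q * p)) - 2 • (f * (p * p)) +
    2 • (q * (q * e))

namespace SchRel

variable {A : Type*} [Ring A] {e h f p q z : A} (D : SchRel e h f p q z)
include D


/-- Both sides are rewritten into monomials ordered as `z, f, q, h, p, e` and compared. The
auxiliary identities are the relations in the form needed inside a right-associated product. -/
theorem cubicCasimir_comm : (∀ x ∈ ({e, h, f, p, q, z} : Set A),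
    x * cubicCasimir e h f p q z = cubicCasimir e h f p q z * x) := by
  have r1 : ∀ x, h * (f * x) = f * (h * x) - 2 • (f * x) := fun x => by
    rw [← mul_assoc, D.hf, sub_mul, mul_assoc, smul_mul_assoc]
  have r2 : ∀ x, e * (f * x) = f * (e * x) + h * x := fun x => by
    rw [← mul_assoc, D.ef, add_mul, mul_assoc]
  have r3 : ∀ x, p * (f * x) = f * (p * x) - q * x := fun x => by
    rw [← mul_assoc, D.pf, sub_mul, mul_assoc]
  have r4 : ∀ x, q * (f * x) = f * (q * x) := fun x => by rw [← mul_assoc, D.qf, mul_assoc]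
  have r5 : ∀ x, h * (q * x) = q * (h * x) - q * x := fun x => by
    rw [← mul_assoc, D.hq, sub_mul, mul_assoc]
  have r6 : ∀ x, p * (q * x) = q * (p * x) + z * x := fun x => by
    rw [← mul_assoc, D.pq, add_mul, mul_assoc]
  have r7 : ∀ x, e * (q * x) = q * (e * x) + p * x := fun x => by
    rw [← mul_assoc, D.eq, add_mul, mul_assoc]
  have r8 : ∀ x, p * (h * x) = h * (p * x) - p * x := fun x => by
    rw [← mul_assoc, D.ph, sub_mul, mul_assoc]
  have r9 : ∀ x, e * (h * x) = h * (e * x) - 2 • (e * x) := fun x => by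
    rw [← mul_assoc, D.eh, sub_mul, mul_assoc, smul_mul_assoc]
  have r10 : ∀ x, e * (p * x) = p * (e * x) := fun x => by rw [← mul_assoc, D.ep, mul_assoc]
  have s1 : ∀ x, f * (z * x) = z * (f * x) := fun x => by rw [← mul_assoc, D.fz, mul_assoc]
  have s2 : ∀ x, q * (z * x) = z * (q * x) := fun x => by rw [← mul_assoc, D.qz, mul_assoc]
  have s3 : ∀ x, h * (z * x) = z * (h * x) := fun x => by rw [← mul_assoc, D.hz, mul_assoc]
  have s4 : ∀ x, p * (z * x) = z * (p * x) := fun x => by rw [← mul_assoc, D.pz, mul_assoc]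
  have s5 : ∀ x, e * (z * x) = z * (e * x) := fun x => by rw [← mul_assoc, D.ez, mul_assoc]
  rintro x (rfl | rfl | rfl | rfl | rfl | rfl) <;>
  · simp only [cubicCasimir, mul_add, add_mul, mul_sub, sub_mul, smul_add, smul_sub, mul_smul_comm,
      smul_mul_assoc, mul_assoc, D.hf, D.ef, D.pf, D.hq, D.pq, D.eq, D.ph, D.eh, D.ep, D.fz,
      D.qz, D.hz, D.pz, D.ez, r1, r2, r3, r4, r5, r6, r7, r8, r9, r10, s1, s2, s3, s4, s5]
    try abel

/-- The `sl₂`-triple and the Weyl pair in an algebra in which `z` is a nonzero scalar and the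
cubic Casimir element is a scalar. -/
def weylSlTwo [Algebra ℂ A] {l c : ℂ} (hl : l ≠ 0) (hz : z = l • 1)
    (hc : cubicCasimir e h f p q z = (l * c) • 1) : WeylSlTwo A l (c + 5 / 4) := by
  have hpq : p * q = q * p + l • 1 := by rw [D.pq, hz]
  have r3 : ∀ x, p * (f * x) = f * (p * x) - q * x := fun x => by
    rw [← mul_assoc, D.pf, sub_mul, mul_assoc]
  have r4 : ∀ x, q * (f * x) = f * (q * x) := fun x => by rw [← mul_assoc, D.qf, mul_assoc]
  have r5 : ∀ x, h * (q * x) = q * (h * x) - q * x := fun x => by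
    rw [← mul_assoc, D.hq, sub_mul, mul_assoc]
  have r6 : ∀ x, p * (q * x) = q * (p * x) + l • x := fun x => by
    rw [← mul_assoc, hpq, add_mul, mul_assoc, smul_mul_assoc, one_mul]
  have r7 : ∀ x, e * (q * x) = q * (e * x) + p * x := fun x => by
    rw [← mul_assoc, D.eq, add_mul, mul_assoc]
  have r8 : ∀ x, p * (h * x) = h * (p * x) - p * x := fun x => by
    rw [← mul_assoc, D.ph, sub_mul, mul_assoc]
  -- The elements `p²/(2l)`, `-q²/(2l)`, `-(qp/l + 1/2)` form an `sl₂`-triple whose commutators with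
  -- `p, q` are those of `e, f, h`. Subtracting it leaves a triple that commutes with `p` and `q`.
  refine ⟨e - (1 / (2 * l)) • (p * p), f + (1 / (2 * l)) • (q * q),
    h + (1 / l) • (q * p) + (1 / 2 : ℂ) • 1, p, q, ?_, ?_, ?_, ?_, hpq, ?_, ?_, ?_, ?_, ?_, ?_⟩
  -- The new Casimir element is the cubic one divided by `l`, plus the constant `(1/2)² + 2 · (1/2)
  -- = 5/4` produced by the summand `1/2` of `H`.
  case refine_4 =>
    have hc' : (1 / l) • cubicCasimir e h f p q z = c • 1 := by
      rw [hc, smul_smul]; congr 1; field_simp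
    rw [add_smul, ← hc', cubicCasimir, hz]
    simp only [mul_add, add_mul, mul_sub, smul_add, smul_sub, mul_smul_comm, mul_one, one_mul,
      smul_mul_assoc, mul_assoc, D.ph, r5, r6]
    match_scalars <;> field_simp <;> ring
  all_goals
    simp only [commute_iff_eq, mul_add, add_mul, mul_sub, sub_mul, smul_add, smul_sub,
      mul_smul_comm, mul_one,
      one_mul, smul_mul_assoc, mul_assoc, D.hf, D.ef, D.pf, D.qf, D.hq, hpq, D.eq, D.ph, D.eh, D.ep,
      r3, r4, r5, r6, r7, r8]
    try match_scalars <;> field_simp <;> ring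

theorem adjoin_weylSlTwo [Algebra ℂ A] {l c : ℂ} (hl : l ≠ 0) (hz : z = l • 1)
    (hc : cubicCasimir e h f p q z = (l * c) • 1)
    (hgen : Algebra.adjoin ℂ {e, h, f, p, q, z} = ⊤) :
    Algebra.adjoin ℂ {(D.weylSlTwo hl hz hc).E, (D.weylSlTwo hl hz hc).F,
      (D.weylSlTwo hl hz hc).H, (D.weylSlTwo hl hz hc).P, (D.weylSlTwo hl hz hc).Q} = ⊤ := by
  set S := Algebra.adjoin ℂ {(D.weylSlTwo hl hz hc).E, (D.weylSlTwo hl hz hc).F,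
      (D.weylSlTwo hl hz hc).H, (D.weylSlTwo hl hz hc).P, (D.weylSlTwo hl hz hc).Q} with hS
  have hE : e - (1 / (2 * l)) • (p * p) ∈ S := Algebra.subset_adjoin (Or.inl rfl)
  have hF : f + (1 / (2 * l)) • (q * q) ∈ S := Algebra.subset_adjoin (Or.inr (Or.inl rfl))
  have hH : h + (1 / l) • (q * p) + (1 / 2 : ℂ) • 1 ∈ S :=
    Algebra.subset_adjoin (Or.inr (Or.inr (Or.inl rfl)))
  have hP : p ∈ S := Algebra.subset_adjoin (Or.inr (Or.inr (Or.inr (Or.inl rfl))))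
  have hQ : q ∈ S := Algebra.subset_adjoin (Or.inr (Or.inr (Or.inr (Or.inr rfl))))
  rw [eq_top_iff, ← hgen]
  refine Algebra.adjoin_le ?_
  rintro x (rfl | rfl | rfl | rfl | rfl | rfl)
  · have := add_mem hE (S.smul_mem (mul_mem hP hP) (1 / (2 * l)))
    rwa [sub_add_cancel] at this
  · have := sub_mem (sub_mem hH (S.smul_mem (one_mem S) (1 / 2 : ℂ)))
      (S.smul_mem (mul_mem hQ hP) (1 / l))
    rwa [add_sub_cancel_right, add_sub_cancel_right] at this
  · have := sub_mem hF (S.smul_mem (mul_mem hQ hQ) (1 / (2 * l)))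
    rwa [add_sub_cancel_right] at this
  · exact hP
  · exact hQ
  · rw [hz]; exact S.smul_mem (one_mem S) l

end SchRel

/-! ### The ideal of a central character -/

/-- The central element of `U` given by the cubic Casimir element. -/
def casU : U := cubicCasimir eU hU fU pU qU zU

theorem adjoin_U : Algebra.adjoin ℂ {eU, hU, fU, pU, qU, zU} = ⊤ := by
  refine subalgebra_eq_top _ fun x => ?_
  rw [toU_eq]
  have h : ∀ y ∈ ({eU, hU, fU, pU, qU, zU} : Set U),
      y ∈ Algebra.adjoin ℂ {eU, hU, fU, pU, qU, zU} := fun y hy => Algebra.subset_adjoin hy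
  refine add_mem (add_mem (add_mem (add_mem (add_mem ?_ ?_) ?_) ?_) ?_) ?_ <;>
  exact Subalgebra.smul_mem _ (h _ (by simp)) _

theorem mem_center_of_comm {c : U} (hc : ∀ x ∈ ({eU, hU, fU, pU, qU, zU} : Set U), x * c = c * x) :
    c ∈ Subalgebra.center ℂ U := by
  have h : Algebra.adjoin ℂ {eU, hU, fU, pU, qU, zU} ≤ Subalgebra.centralizer ℂ {c} := by
    refine Algebra.adjoin_le fun x hx => ?_
    rw [SetLike.mem_coe, Subalgebra.mem_centralizer_iff]
    rintro _ rfl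
    exact (hc x hx).symm
  rw [adjoin_U] at h
  rw [Subalgebra.mem_center_iff]
  intro b
  exact ((Subalgebra.mem_centralizer_iff ℂ).1 (h (Algebra.mem_top (x := b))) c rfl).symm

theorem casU_mem_center : casU ∈ Subalgebra.center ℂ U :=
  mem_center_of_comm schRel_U.cubicCasimir_comm

theorem zU_mem_center : zU ∈ Subalgebra.center ℂ U := by
  refine mem_center_of_comm ?_
  rintro x (rfl | rfl | rfl | rfl | rfl | rfl)
  exacts [schRel_U.ez, schRel_U.hz, schRel_U.fz, schRel_U.pz, schRel_U.qz, rfl]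

/-- The generators of the annihilator. -/
def centralGens (l c : ℂ) : Set U := {zU - l • 1, casU - (l * c) • 1}

theorem centralGens_subset_center (l c : ℂ) :
    centralGens l c ⊆ (Subalgebra.center ℂ U : Set U) := by
  rintro x (rfl | rfl)
  · exact sub_mem zU_mem_center (Subalgebra.smul_mem _ (one_mem _) _)
  · exact sub_mem casU_mem_center (Subalgebra.smul_mem _ (one_mem _) _)

/-- The ideal generated by the central elements `z - l` and `C - l c`. -/
def centralIdeal (l c : ℂ) : Ideal U := Ideal.span (centralGens l c)

/-- `Ideal` means left ideal over a noncommutative ring; centrality of the generators gives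
absorption on the right, so that the quotient is an algebra. -/
instance (l c : ℂ) : (centralIdeal l c).IsTwoSided := by
  refine ⟨fun {a} b ha => ?_⟩
  induction ha using Submodule.span_induction with
  | mem x hx =>
    rw [← Subalgebra.mem_center_iff.1 (centralGens_subset_center l c hx) b]
    exact Ideal.mul_mem_left _ _ (Ideal.subset_span hx)
  | zero => rw [zero_mul]; exact zero_mem _
  | add x y _ _ hx hy => rw [add_mul]; exact add_mem hx hy
  | smul r x _ hx => rw [smul_eq_mul, mul_assoc]; exact Ideal.mul_mem_left _ _ hx

/-- A nonzero module killed by `z - l` and `C - l c` has no further annihilators, if the central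
character of its `sl₂`-part is not that of a finite-dimensional module. -/
theorem annihilator_eq_centralIdeal {l c : ℂ} (hl : l ≠ 0)
    (hck : ∀ k : ℕ, (k : ℂ) ^ 2 + 2 * k ≠ c + 5 / 4)
    (N : Type*) [AddCommGroup N] [Module ℂ N] [Module U N] [IsScalarTower ℂ U N] [Nontrivial N]
    (hz : ∀ x : N, zU • x = l • x) (hcas : ∀ x : N, casU • x = (l * c) • x) :
    Module.annihilator U N = centralIdeal l c := by
  have hle : centralIdeal l c ≤ Module.annihilator U N := by
    refine Ideal.span_le.2 ?_
    rintro x (rfl | rfl) <;> refine Module.mem_annihilator.2 fun y => ?_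
    · rw [sub_smul, hz, smul_assoc, one_smul, sub_self]
    · rw [sub_smul, hcas, smul_assoc, one_smul, sub_self]
  refine le_antisymm (fun u hu => ?_) hle
  let J := centralIdeal l c
  let π : U →ₐ[ℂ] U ⧸ J := Ideal.Quotient.mkₐ ℂ J
  have hπ : ∀ u, π u = 0 ↔ u ∈ J := fun u => Ideal.Quotient.eq_zero_iff_mem
  let ρ : (U ⧸ J) →ₐ[ℂ] Module.End ℂ N := Ideal.Quotient.liftₐ J (Algebra.lsmul ℂ ℂ N)
    (fun a ha => LinearMap.ext fun x => Module.mem_annihilator.1 (hle ha) x)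
  have hρ : ∀ u x, ρ (π u) x = u • x := fun u x => rfl
  have D : SchRel (π eU) (π hU) (π fU) (π pU) (π qU) (π zU) := by
    constructor
    · simpa only [map_mul, map_sub, map_nsmul] using congrArg π schRel_U.hf
    · simpa only [map_mul, map_add] using congrArg π schRel_U.ef
    · simpa only [map_mul, map_sub] using congrArg π schRel_U.pf
    · simpa only [map_mul] using congrArg π schRel_U.qf
    · simpa only [map_mul, map_sub] using congrArg π schRel_U.hq
    · simpa only [map_mul, map_add] using congrArg π schRel_U.pq
    · simpa only [map_mul, map_add] using congrArg π schRel_U.eq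
    · simpa only [map_mul, map_sub] using congrArg π schRel_U.ph
    · simpa only [map_mul, map_sub, map_nsmul] using congrArg π schRel_U.eh
    · simpa only [map_mul] using congrArg π schRel_U.ep
    · simpa only [map_mul] using congrArg π schRel_U.fz
    · simpa only [map_mul] using congrArg π schRel_U.qz
    · simpa only [map_mul] using congrArg π schRel_U.hz
    · simpa only [map_mul] using congrArg π schRel_U.pz
    · simpa only [map_mul] using congrArg π schRel_U.ez
  have hz' : π zU = l • 1 := by
    have h := (hπ _).2 (Ideal.subset_span (Or.inl rfl) : zU - l • 1 ∈ J)
    rwa [map_sub, map_smul, map_one, sub_eq_zero] at h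
  have hc' : cubicCasimir (π eU) (π hU) (π fU) (π pU) (π qU) (π zU) = (l * c) • 1 := by
    have h := (hπ _).2 (Ideal.subset_span (Or.inr rfl) : casU - (l * c) • 1 ∈ J)
    rw [map_sub, map_smul, map_one, sub_eq_zero] at h
    rw [← h]
    simp only [casU, cubicCasimir, map_add, map_sub, map_mul, map_nsmul]
  have hgen : Algebra.adjoin ℂ {π eU, π hU, π fU, π pU, π qU, π zU} = ⊤ := by
    have h := AlgHom.map_adjoin π {eU, hU, fU, pU, qU, zU}
    rw [adjoin_U, Algebra.map_top, (AlgHom.range_eq_top π).2 Ideal.Quotient.mk_surjective] at h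
    simpa only [Set.image_insert_eq, Set.image_singleton] using h.symm
  -- The action descends to the quotient by the central ideal and is faithful there, so an element
  -- acting by zero already lies in the ideal.
  have hinj := (D.weylSlTwo hl hz' hc').injective_of_nontrivial hl hck
    (D.adjoin_weylSlTwo hl hz' hc' hgen) ρ
  refine (hπ u).1 (hinj ?_)
  rw [map_zero]
  exact LinearMap.ext fun x => Module.mem_annihilator.1 hu x

/-! ## The action of the center -/

section BalancedLift

variable {A R B M P : Type*} [Ring A] [Algebra ℂ A] [Ring R]
  [AddCommGroup B] [Module ℂ B] [Module A B] [IsScalarTower ℂ A B] [Module Rᵐᵒᵖ B]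
  [AddCommGroup M] [Module ℂ M] [Module R M]
  [AddCommGroup P] [Module ℂ P] [Module A P] [IsScalarTower ℂ A P]

variable (A R) in
/-- The pure tensor `b ⊗ m`. -/
def btmul (b : B) (m : M) : BalancedTensor A R B M := Submodule.Quotient.mk (b ⊗ₜ[ℂ] m)

theorem btmul_smul_right (b : B) (c : ℂ) (m : M) :
    btmul A R b (c • m) = c • btmul A R b m := by
  simp only [btmul, TensorProduct.tmul_smul, Submodule.Quotient.mk_smul]

theorem btmul_sub_left (b b' : B) (m : M) :
    btmul A R (b - b') m = btmul A R b m - btmul A R b' m := by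
  simp [btmul, TensorProduct.sub_tmul]

theorem btmul_smul_left (c : ℂ) (b : B) (m : M) :
    btmul A R (c • b) m = c • btmul A R b m := by
  simp only [btmul, ← TensorProduct.smul_tmul', Submodule.Quotient.mk_smul]

theorem smul_btmul (a : A) (b : B) (m : M) : a • btmul A R b m = btmul A R (a • b) m := rfl

theorem btmul_op_smul (b : B) (r : R) (m : M) :
    btmul A R (MulOpposite.op r • b) m = btmul A R b (r • m) :=
  (Submodule.Quotient.eq _).2 (Submodule.subset_span ⟨b, r, m, rfl⟩)

theorem balancedTensor_induction {motive : BalancedTensor A R B M → Prop}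
    (zero : motive 0) (btmul : ∀ b m, motive (btmul A R b m))
    (add : ∀ x y, motive x → motive y → motive (x + y)) (x : BalancedTensor A R B M) :
    motive x := by
  induction x using Submodule.Quotient.induction_on with | _ x =>
  induction x using TensorProduct.induction_on with
  | zero => exact zero
  | tmul b m => exact btmul b m
  | add x y hx hy => exact add _ _ hx hy

/-- The map out of a tensor product given by a balanced map. -/
def balancedLift (g : B →ₗ[A] M →ₗ[ℂ] P) (hg : ∀ b (r : R) m,
    g (MulOpposite.op r • b) m = g b (r • m)) : BalancedTensor A R B M →ₗ[A] P :=
  (balancedRel A R B M).liftQ (TensorProduct.AlgebraTensorModule.lift g) <| by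
    refine Submodule.span_le.2 ?_
    rintro _ ⟨b, r, m, rfl⟩
    simp [hg]

theorem balancedLift_btmul (g : B →ₗ[A] M →ₗ[ℂ] P) (hg : ∀ b (r : R) m,
    g (MulOpposite.op r • b) m = g b (r • m)) (b : B) (m : M) :
    balancedLift g hg (btmul A R b m) = g b m := rfl

end BalancedLift

/-! ### Highest weight vectors and central characters -/

/-- The basis vector of `ℂ_λ`. -/
def cLamOne (l₁ l₂ : ℂ) : CLam l₁ l₂ := (1 : ℂ)

theorem exists_eq_smul_cLamOne {l₁ l₂ : ℂ} (m : CLam l₁ l₂) : ∃ a : ℂ, m = a • cLamOne l₁ l₂ :=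
  ⟨m, (mul_one (show ℂ from m)).symm⟩

theorem ι_smul_cLamOne {l₁ l₂ : ℂ} (x : borel) :
    (UniversalEnvelopingAlgebra.ι ℂ x : UB) • cLamOne l₁ l₂ =
      (l₁ * x.1.h + l₂ * x.1.z) • cLamOne l₁ l₂ := by
  change UniversalEnvelopingAlgebra.lift ℂ (borelChar l₁ l₂)
    (UniversalEnvelopingAlgebra.ι ℂ x) * (1 : ℂ) = (l₁ * x.1.h + l₂ * x.1.z) * (1 : ℂ)
  rw [UniversalEnvelopingAlgebra.lift_ι_apply]
  rfl

/-- The highest weight vector of the Verma module. -/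
def hwVec (l₁ l₂ : ℂ) : Verma l₁ l₂ := btmul U UB 1 (cLamOne l₁ l₂)

theorem toU_smul_hwVec {l₁ l₂ : ℂ} (x : borel) :
    toU x.1 • hwVec l₁ l₂ = (l₁ * x.1.h + l₂ * x.1.z) • hwVec l₁ l₂ := by
  have h : toU x.1 • (1 : U) = MulOpposite.op (UniversalEnvelopingAlgebra.ι ℂ x : UB) • (1 : U) := by
    change _ = 1 * UBtoU (UniversalEnvelopingAlgebra.ι ℂ x)
    rw [UBtoU, UniversalEnvelopingAlgebra.lift_ι_apply, one_mul, smul_eq_mul, mul_one]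
    rfl
  rw [hwVec, smul_btmul, h, btmul_op_smul, ι_smul_cLamOne, btmul_smul_right]

theorem eU_smul_hwVec (l₁ l₂ : ℂ) : eU • hwVec l₁ l₂ = 0 := by
  have h := toU_smul_hwVec (l₁ := l₁) (l₂ := l₂) ⟨⟨1, 0, 0, 0, 0, 0⟩, rfl, rfl⟩
  simpa [eU] using h

theorem pU_smul_hwVec (l₁ l₂ : ℂ) : pU • hwVec l₁ l₂ = 0 := by
  have h := toU_smul_hwVec (l₁ := l₁) (l₂ := l₂) ⟨⟨0, 0, 0, 1, 0, 0⟩, rfl, rfl⟩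
  simpa [pU] using h

theorem hU_smul_hwVec (l₁ l₂ : ℂ) : hU • hwVec l₁ l₂ = l₁ • hwVec l₁ l₂ := by
  have h := toU_smul_hwVec (l₁ := l₁) (l₂ := l₂) ⟨⟨0, 1, 0, 0, 0, 0⟩, rfl, rfl⟩
  simpa [hU] using h

theorem zU_smul_hwVec (l₁ l₂ : ℂ) : zU • hwVec l₁ l₂ = l₂ • hwVec l₁ l₂ := by
  have h := toU_smul_hwVec (l₁ := l₁) (l₂ := l₂) ⟨⟨0, 0, 0, 0, 0, 1⟩, rfl, rfl⟩
  simpa [zU] using h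

theorem smul_smul_comm {M : Type*} [AddCommGroup M] [Module ℂ M] [Module U M]
    [IsScalarTower ℂ U M] (u : U) (c : ℂ) (m : M) : u • c • m = c • u • m := by
  rw [← algebraMap_smul U c m, ← mul_smul, ← Algebra.commutes, mul_smul, algebraMap_smul]

/-- Every term ending in `e` or `p` dies on the highest weight vector, leaving `z (h² + 3h)`. -/
theorem casU_smul_hwVec (l₁ l₂ : ℂ) :
    casU • hwVec l₁ l₂ = (l₂ * (l₁ ^ 2 + 3 * l₁)) • hwVec l₁ l₂ := by
  simp only [casU, cubicCasimir, add_smul, sub_smul, mul_smul, smul_add, smul_assoc, eU_smul_hwVec,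
    pU_smul_hwVec, hU_smul_hwVec, smul_zero, smul_smul_comm, zU_smul_hwVec,
    ← Nat.cast_smul_eq_nsmul ℂ]
  module

theorem exists_smul_hwVec {l₁ l₂ : ℂ} (x : Verma l₁ l₂) : ∃ u : U, x = u • hwVec l₁ l₂ := by
  induction x using balancedTensor_induction with
  | zero => exact ⟨0, (zero_smul _ _).symm⟩
  | btmul b m =>
    obtain ⟨a, rfl⟩ := exists_eq_smul_cLamOne m
    refine ⟨a • b, ?_⟩
    rw [hwVec, smul_btmul, smul_eq_mul, mul_one, btmul_smul_left, btmul_smul_right]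
  | add x y hx hy =>
    obtain ⟨u, rfl⟩ := hx
    obtain ⟨v, rfl⟩ := hy
    exact ⟨u + v, (add_smul _ _ _).symm⟩

theorem smul_eq_of_mem_center {l₁ l₂ a : ℂ} {c : U} (hc : c ∈ Subalgebra.center ℂ U)
    (h : c • hwVec l₁ l₂ = a • hwVec l₁ l₂) (x : Verma l₁ l₂) : c • x = a • x := by
  obtain ⟨u, rfl⟩ := exists_smul_hwVec x
  rw [← mul_smul, ← Subalgebra.mem_center_iff.1 hc u, mul_smul, h, smul_smul_comm]

theorem smul_Uf_eq (u : U) (x : Uf) : u • x = UtoUf u * x := by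
  have h : u • (1 : Uf) = UtoUf u := by
    rw [← OreLocalization.oreDiv_one_smul (S := Submonoid.powers fU), smul_eq_mul, mul_one]
    rfl
  rw [← h, smul_mul_assoc, one_mul]

/-- Commutation with a fraction can be tested after multiplying by its denominator, a unit, where
everything takes place in `U`. -/
theorem UtoUf_comm_of_mem_center {c : U} (hc : c ∈ Subalgebra.center ℂ U) (x : Uf) :
    UtoUf c * x = x * UtoUf c := by
  induction x using OreLocalization.ind with | _ r s =>
  have hs : UtoUf (s : U) * (r /ₒ s) = UtoUf r := OreLocalization.mul_cancel
  have hu : IsUnit (UtoUf (s : U)) := OreLocalization.numerator_isUnit s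
  refine hu.mul_left_cancel ?_
  rw [← mul_assoc, ← mul_assoc, hs, ← map_mul, Subalgebra.mem_center_iff.1 hc, map_mul, mul_assoc,
    hs, ← map_mul, ← map_mul, Subalgebra.mem_center_iff.1 hc]

theorem smul_Sf_eq_op_smul {c : U} (hc : c ∈ Subalgebra.center ℂ U) (x : Sf) :
    c • x = MulOpposite.op c • x := by
  induction x using Submodule.Quotient.induction_on with | _ x =>
  change Submodule.Quotient.mk (c • x) = Submodule.Quotient.mk (x * UtoUf c)
  rw [smul_Uf_eq, UtoUf_comm_of_mem_center hc]

/-- The left and right actions of a central element on `S_f` agree, so it can be carried across the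
tensor sign to act on `M`. -/
theorem smul_tensor_eq_of_mem_center {M : Type*} [AddCommGroup M] [Module ℂ M] [Module U M]
    {a : ℂ} {c : U} (hc : c ∈ Subalgebra.center ℂ U) (h : ∀ m : M, c • m = a • m)
    (x : BalancedTensor U U Sf M) : c • x = a • x := by
  induction x using balancedTensor_induction with
  | zero => rw [smul_zero, smul_zero]
  | btmul b m => rw [smul_btmul, smul_Sf_eq_op_smul hc, btmul_op_smul, h, btmul_smul_right]
  | add x y hx hy => rw [smul_add, smul_add, hx, hy]

/-! ## A model of the localized Verma module -/

/-- Elements of an algebra that satisfy the defining relations give a representation of the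
Schrödinger algebra. -/
def SchRel.toLieHom {A : Type*} [Ring A] [Algebra ℂ A] {e h f p q z : A}
    (D : SchRel e h f p q z) : Sch →ₗ⁅ℂ⁆ A where
  toFun x := x.e • e + x.h • h + x.f • f + x.p • p + x.q • q + x.z • z
  map_add' x y := by
    simp only [Sch.add_e, Sch.add_h, Sch.add_f, Sch.add_p, Sch.add_q, Sch.add_z]
    module
  map_smul' c x := by
    simp only [Sch.smul_e, Sch.smul_h, Sch.smul_f, Sch.smul_p, Sch.smul_q, Sch.smul_z,
      RingHom.id_apply]
    module
  map_lie' {x y} := by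
    simp only [LieRing.of_associative_ring_bracket, Sch.lie_e, Sch.lie_h, Sch.lie_f, Sch.lie_p,
      Sch.lie_q, Sch.lie_z, mul_add, add_mul, smul_mul_assoc, mul_smul_comm, D.hf, D.ef, D.pf, D.qf,
      D.hq, D.pq, D.eq, D.ph, D.eh, D.ep, D.fz, D.qz, D.hz, D.pz, D.ez]
    module

/-- The space of the functions on `ℤ × ℤ`; the value at `(i, j)` is the coefficient of the formal
vector `f ^ i q ^ j v`, for a highest weight vector `v`. -/
abbrev Coeffs : Type := ℤ → ℤ → ℂ

namespace Coeffs

/-- The action of `e`. -/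
def opE (l₁ l₂ : ℂ) : Module.End ℂ Coeffs where
  -- From `e f^i q^j v = l₂ j (j-1)/2 f^i q^(j-2) v + i (l₁ - j - i + 1) f^(i-1) q^j v`, indexed by
  -- the target monomial. The coefficients are polynomial in `i, j`, so negative exponents are
  -- allowed.
  toFun φ i j := l₂ * (j + 2) * (j + 1) / 2 * φ i (j + 2) + (i + 1) * (l₁ - j - i) * φ (i + 1) j
  map_add' φ ψ := by ext i j; simp only [Pi.add_apply]; ring
  map_smul' c φ := by ext i j; simp only [Pi.smul_apply, smul_eq_mul, RingHom.id_apply]; ring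

/-- The action of `h`. -/
def opH (l₁ : ℂ) : Module.End ℂ Coeffs where
  toFun φ i j := (l₁ - 2 * i - j) * φ i j
  map_add' φ ψ := by ext i j; simp only [Pi.add_apply]; ring
  map_smul' c φ := by ext i j; simp only [Pi.smul_apply, smul_eq_mul, RingHom.id_apply]; ring

/-- The translation in the first variable. -/
def shift (k : ℤ) : Module.End ℂ Coeffs where
  toFun φ i j := φ (i - k) j
  map_add' _ _ := rfl
  map_smul' _ _ := rfl

/-- The action of `p`. -/
def opP (l₂ : ℂ) : Module.End ℂ Coeffs where
  toFun φ i j := -(i + 1) * φ (i + 1) (j - 1) + (j + 1) * l₂ * φ i (j + 1)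
  map_add' φ ψ := by ext i j; simp only [Pi.add_apply]; ring
  map_smul' c φ := by ext i j; simp only [Pi.smul_apply, smul_eq_mul, RingHom.id_apply]; ring

/-- The action of `q`. -/
def opQ : Module.End ℂ Coeffs where
  toFun φ i j := φ i (j - 1)
  map_add' _ _ := rfl
  map_smul' _ _ := rfl

theorem opE_apply (l₁ l₂ : ℂ) (φ : Coeffs) (i j : ℤ) : opE l₁ l₂ φ i j =
    l₂ * (j + 2) * (j + 1) / 2 * φ i (j + 2) + (i + 1) * (l₁ - j - i) * φ (i + 1) j := rfl
theorem opH_apply (l₁ : ℂ) (φ : Coeffs) (i j : ℤ) :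
    opH l₁ φ i j = (l₁ - 2 * i - j) * φ i j := rfl
theorem shift_apply (k : ℤ) (φ : Coeffs) (i j : ℤ) : shift k φ i j = φ (i - k) j := rfl
theorem opP_apply (l₂ : ℂ) (φ : Coeffs) (i j : ℤ) : opP l₂ φ i j =
    -(i + 1) * φ (i + 1) (j - 1) + (j + 1) * l₂ * φ i (j + 1) := rfl
theorem opQ_apply (φ : Coeffs) (i j : ℤ) : opQ φ i j = φ i (j - 1) := rfl

/-- Each value of an operator involves finitely many values of the function, so no support condition
is needed, and the relations become polynomial identities in `i, j`. -/
theorem schRel (l₁ l₂ : ℂ) :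
    SchRel (opE l₁ l₂) (opH l₁) (shift 1) (opP l₂) opQ (l₂ • (1 : Module.End ℂ Coeffs)) := by
  constructor
  case fz | qz | hz | pz | ez => simp only [mul_smul_comm, smul_mul_assoc, mul_one, one_mul]
  all_goals
    refine LinearMap.ext fun φ => funext fun i => funext fun j => ?_
    simp only [Module.End.mul_apply, LinearMap.add_apply, LinearMap.sub_apply, LinearMap.smul_apply,
      Module.End.one_apply, Pi.add_apply, Pi.sub_apply, Pi.smul_apply, smul_eq_mul,
      ← Nat.cast_smul_eq_nsmul ℂ, opE_apply, opH_apply, shift_apply, opP_apply, opQ_apply]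
    try (push_cast; ring_nf)

/-- The representation of `U` on the coefficient functions. -/
def rep (l₁ l₂ : ℂ) : U →ₐ[ℂ] Module.End ℂ Coeffs :=
  UniversalEnvelopingAlgebra.lift ℂ (schRel l₁ l₂).toLieHom

theorem rep_toU (l₁ l₂ : ℂ) (x : Sch) : rep l₁ l₂ (toU x) = x.e • opE l₁ l₂ + x.h • opH l₁ +
    x.f • shift 1 + x.p • opP l₂ + x.q • opQ + x.z • (l₂ • (1 : Module.End ℂ Coeffs)) :=
  UniversalEnvelopingAlgebra.lift_ι_apply ℂ _ x

theorem rep_fU (l₁ l₂ : ℂ) : rep l₁ l₂ fU = shift 1 := by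
  rw [fU, rep_toU]; simp

theorem rep_qU (l₁ l₂ : ℂ) : rep l₁ l₂ qU = opQ := by
  rw [qU, rep_toU]; simp

/-- The coefficient function of the highest weight vector. -/
def vac : Coeffs := fun i j => if i = 0 ∧ j = 0 then 1 else 0

theorem rep_toU_vac (l₁ l₂ : ℂ) (x : borel) :
    rep l₁ l₂ (toU x.1) vac = (l₁ * x.1.h + l₂ * x.1.z) • vac := by
  have hx := x.2
  change x.1.f = 0 ∧ x.1.q = 0 at hx
  rw [rep_toU, hx.1, hx.2]
  have hE : opE l₁ l₂ vac = 0 := by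
    funext i j
    simp only [opE_apply, vac, Pi.zero_apply]
    -- The value at `(0, 0)` could only reach `j = -2` or `i = -1`, where the factors `j + 2` and `i
    -- + 1` vanish.
    split_ifs with h₁ h₂ h₂
    · omega
    · rw [show j = -2 by omega]; simp
    · rw [show i = -1 by omega]; simp
    · simp
  have hP : opP l₂ vac = 0 := by
    funext i j
    simp only [opP_apply, vac, Pi.zero_apply]
    split_ifs with h₁ h₂ h₂
    · omega
    · rw [show i = -1 by omega]; simp
    · rw [show j = -1 by omega]; simp
    · simp
  have hH : opH l₁ vac = l₁ • vac := by
    funext i j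
    simp only [opH_apply, vac, Pi.smul_apply, smul_eq_mul]
    split_ifs with h
    · rw [h.1, h.2]; simp
    · simp
  simp only [LinearMap.add_apply, LinearMap.smul_apply, hE, hP, hH, Module.End.one_apply]
  module

/-- The functions that vanish where the first variable is negative. -/
def nonneg : Submodule ℂ Coeffs where
  carrier := {φ | ∀ i < 0, ∀ j, φ i j = 0}
  zero_mem' := fun _ _ _ => rfl
  add_mem' := fun {φ ψ} hφ hψ i hi j => by rw [Pi.add_apply, Pi.add_apply, hφ i hi, hψ i hi, add_zero]
  smul_mem' := fun c φ hφ i hi j => by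
    rw [Pi.smul_apply, Pi.smul_apply, hφ i hi, smul_zero]

theorem vac_mem_nonneg : vac ∈ nonneg := fun _ hi _ => if_neg fun h => hi.ne h.1

/-- Only `e` and `p` lower the power of `f`, and the factor `i + 1` blocks the passage from `0` to
`-1`. Dividing by this subspace in the model corresponds to dividing `U_(f)` by `U`. -/
theorem rep_mem_nonneg (l₁ l₂ : ℂ) (u : U) : ∀ φ ∈ nonneg, rep l₁ l₂ u φ ∈ nonneg := by
  let S : Subalgebra ℂ U :=
    { carrier := {u | ∀ φ ∈ nonneg, rep l₁ l₂ u φ ∈ nonneg}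
      mul_mem' := fun {a b} ha hb φ hφ => by
        rw [map_mul]; exact ha _ (hb φ hφ)
      add_mem' := fun {a b} ha hb φ hφ => by
        rw [map_add]; exact add_mem (ha φ hφ) (hb φ hφ)
      algebraMap_mem' := fun c φ hφ => by
        rw [AlgHom.commutes, Module.algebraMap_end_apply]; exact nonneg.smul_mem c hφ }
  have hS : S = ⊤ := subalgebra_eq_top S fun x φ hφ => by
    rw [rep_toU]
    have hE : opE l₁ l₂ φ ∈ nonneg := fun i hi j => by
      rw [opE_apply, hφ i hi]
      rcases eq_or_ne i (-1) with rfl | h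
      · simp
      · rw [hφ (i + 1) (by omega)]; simp
    have hP : opP l₂ φ ∈ nonneg := fun i hi j => by
      rw [opP_apply, hφ i hi]
      rcases eq_or_ne i (-1) with rfl | h
      · simp
      · rw [hφ (i + 1) (by omega)]; simp
    have hH : opH l₁ φ ∈ nonneg := fun i hi j => by rw [opH_apply, hφ i hi, mul_zero]
    have hF : shift 1 φ ∈ nonneg := fun i hi j => hφ _ (by omega) _
    have hQ : opQ φ ∈ nonneg := fun i hi j => hφ _ hi _
    simp only [LinearMap.add_apply, LinearMap.smul_apply, Module.End.one_apply]
    exact add_mem (add_mem (add_mem (add_mem (add_mem (nonneg.smul_mem _ hE) (nonneg.smul_mem _ hH))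
      (nonneg.smul_mem _ hF)) (nonneg.smul_mem _ hP)) (nonneg.smul_mem _ hQ))
      (nonneg.smul_mem _ (nonneg.smul_mem _ hφ))
  have : u ∈ S := hS ▸ Algebra.mem_top
  exact this

/-- The translation by one in the first variable, as a unit. -/
def shiftUnit : (Module.End ℂ Coeffs)ˣ where
  val := shift 1
  inv := shift (-1)
  val_inv := LinearMap.ext fun φ => funext fun i => funext fun j => by
    simp [shift_apply]
  inv_val := LinearMap.ext fun φ => funext fun i => funext fun j => by
    simp [shift_apply]

end Coeffs

/-- The coefficient functions as a `U`-module. -/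
@[nolint unusedArguments]
def CoeffMod (_l₁ _l₂ : ℂ) : Type := Coeffs

instance (l₁ l₂ : ℂ) : AddCommGroup (CoeffMod l₁ l₂) := inferInstanceAs (AddCommGroup Coeffs)
instance (l₁ l₂ : ℂ) : Module ℂ (CoeffMod l₁ l₂) := inferInstanceAs (Module ℂ Coeffs)
instance (l₁ l₂ : ℂ) : Module U (CoeffMod l₁ l₂) :=
  Module.compHom Coeffs (Coeffs.rep l₁ l₂).toRingHom
instance (l₁ l₂ : ℂ) : IsScalarTower ℂ U (CoeffMod l₁ l₂) where
  smul_assoc c u φ := LinearMap.congr_fun (map_smul (Coeffs.rep l₁ l₂) c u) φ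

/-- The coordinate on `ℂ_λ`. -/
def cLamCoord (l₁ l₂ : ℂ) : CLam l₁ l₂ →ₗ[ℂ] ℂ where
  toFun c := c
  map_add' _ _ := rfl
  map_smul' _ _ := rfl

section VermaLift

variable {l₁ l₂ : ℂ} {P : Type*} [AddCommGroup P] [Module ℂ P] [Module U P] [IsScalarTower ℂ U P]

theorem UBtoU_smul_of_highestWeight {w : P}
    (hw : ∀ x : borel, toU x.1 • w = (l₁ * x.1.h + l₂ * x.1.z) • w) (r : UB) :
    UBtoU r • w = UniversalEnvelopingAlgebra.lift ℂ (borelChar l₁ l₂) r • w := by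
  let S : Subalgebra ℂ UB :=
    { carrier := {r | UBtoU r • w = UniversalEnvelopingAlgebra.lift ℂ (borelChar l₁ l₂) r • w}
      mul_mem' := fun {a b} ha hb => by
        change _ = _ at ha hb
        change _ = _
        rw [map_mul, mul_smul, hb, smul_smul_comm, ha, map_mul, mul_comm, mul_smul]
      add_mem' := fun {a b} ha hb => by
        change _ = _ at ha hb
        change _ = _
        rw [map_add, add_smul, ha, hb, map_add, add_smul]
      algebraMap_mem' := fun c => by
        change _ = _
        rw [AlgHom.commutes, AlgHom.commutes, algebraMap_smul]
        rfl }
  let g : borel →ₗ⁅ℂ⁆ S :=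
    { toFun := fun x => ⟨UniversalEnvelopingAlgebra.ι ℂ x, by
        change _ = _
        rw [UBtoU, UniversalEnvelopingAlgebra.lift_ι_apply,
          UniversalEnvelopingAlgebra.lift_ι_apply]
        exact hw x⟩
      map_add' := fun x y => by ext; simp
      map_smul' := fun c x => by ext; simp
      map_lie' := fun {x y} => by
        ext
        simp [LieRing.of_associative_ring_bracket] }
  have hg : S.val.comp (UniversalEnvelopingAlgebra.lift ℂ g) = AlgHom.id ℂ UB := by
    apply UniversalEnvelopingAlgebra.hom_ext
    ext x
    simp [g]
  have h := DFunLike.congr_fun hg r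
  simp only [AlgHom.comp_apply, AlgHom.id_apply] at h
  have hr : r ∈ S := h ▸ (UniversalEnvelopingAlgebra.lift ℂ g r).2
  exact hr

/-- The map from the Verma module given by a highest weight vector. -/
def vermaLift (w : P) (hw : ∀ x : borel, toU x.1 • w = (l₁ * x.1.h + l₂ * x.1.z) • w) :
    Verma l₁ l₂ →ₗ[U] P :=
  balancedLift
    { toFun := fun u => (cLamCoord l₁ l₂).smulRight (u • w)
      map_add' := fun u v => LinearMap.ext fun c => by
        simp only [LinearMap.smulRight_apply, add_smul, smul_add, LinearMap.add_apply]
      map_smul' := fun u v => LinearMap.ext fun c => by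
        simp only [LinearMap.smulRight_apply, smul_eq_mul, mul_smul, LinearMap.smul_apply,
          RingHom.id_apply, smul_smul_comm] } <| fun u r c => by
    have h1 : cLamCoord l₁ l₂ (r • c) =
      UniversalEnvelopingAlgebra.lift ℂ (borelChar l₁ l₂) r * cLamCoord l₁ l₂ c := rfl
    have h2 : MulOpposite.op r • u = u * UBtoU r := rfl
    simp only [LinearMap.coe_mk, AddHom.coe_mk, LinearMap.smulRight_apply]
    rw [h1, h2, mul_smul, UBtoU_smul_of_highestWeight hw, smul_smul_comm, mul_comm, mul_smul]

theorem vermaLift_hwVec (w : P)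
    (hw : ∀ x : borel, toU x.1 • w = (l₁ * x.1.h + l₂ * x.1.z) • w) :
    vermaLift w hw (hwVec l₁ l₂) = w := by
  rw [vermaLift, hwVec, balancedLift_btmul]
  change (1 : ℂ) • (1 : U) • w = w
  rw [one_smul, one_smul]

end VermaLift

/-- The map from the Verma module to its model. -/
def vermaToCoeff (l₁ l₂ : ℂ) : Verma l₁ l₂ →ₗ[U] CoeffMod l₁ l₂ :=
  vermaLift (show CoeffMod l₁ l₂ from Coeffs.vac) (Coeffs.rep_toU_vac l₁ l₂)

theorem vermaToCoeff_hwVec (l₁ l₂ : ℂ) :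
    vermaToCoeff l₁ l₂ (hwVec l₁ l₂) = (Coeffs.vac : Coeffs) :=
  vermaLift_hwVec _ _

theorem vermaToCoeff_smul_hwVec (l₁ l₂ : ℂ) (u : U) :
    vermaToCoeff l₁ l₂ (u • hwVec l₁ l₂) = Coeffs.rep l₁ l₂ u Coeffs.vac := by
  rw [map_smul, vermaToCoeff_hwVec]
  rfl

theorem vermaToCoeff_mem_nonneg (l₁ l₂ : ℂ) (m : Verma l₁ l₂) :
    (show Coeffs from vermaToCoeff l₁ l₂ m) ∈ Coeffs.nonneg := by
  obtain ⟨u, rfl⟩ := exists_smul_hwVec m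
  rw [vermaToCoeff_smul_hwVec]
  exact Coeffs.rep_mem_nonneg l₁ l₂ u _ Coeffs.vac_mem_nonneg

/-- The Verma module is a quotient, so its generator is shown to be nonzero through its image in the
model, whose value at `(0, 0)` is `1`. -/
instance (l₁ l₂ : ℂ) : Nontrivial (Verma l₁ l₂) := by
  refine ⟨⟨hwVec l₁ l₂, 0, fun h => ?_⟩⟩
  have h1 := congrArg (vermaToCoeff l₁ l₂) h
  rw [vermaToCoeff_hwVec, map_zero] at h1
  have h2 := congrFun (congrFun h1 0) 0
  exact one_ne_zero ((if_pos ⟨rfl, rfl⟩).symm.trans h2)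

/-! ## The localization acts on the model -/

/-- The powers of `f`, as automorphisms of the model. -/
def powersToUnits (l₁ l₂ : ℂ) : Submonoid.powers fU →* (Module.End ℂ Coeffs)ˣ :=
  IsUnit.liftRight ((Coeffs.rep l₁ l₂ : U →* Module.End ℂ Coeffs).comp
    (Submonoid.powers fU).subtype) <| by
      rintro ⟨_, n, rfl⟩
      change IsUnit (Coeffs.rep l₁ l₂ (fU ^ n))
      rw [map_pow, Coeffs.rep_fU]
      exact Coeffs.shiftUnit.isUnit.pow n

theorem powersToUnits_coe (l₁ l₂ : ℂ) (s : Submonoid.powers fU) :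
    (Coeffs.rep l₁ l₂).toRingHom (s : U) = (powersToUnits l₁ l₂ s : Module.End ℂ Coeffs) := rfl

/-- The representation of `U_(f)` on the coefficient functions. -/
def repUf (l₁ l₂ : ℂ) : Uf →+* Module.End ℂ Coeffs :=
  OreLocalization.universalHom (Coeffs.rep l₁ l₂).toRingHom (powersToUnits l₁ l₂)
    (powersToUnits_coe l₁ l₂)

theorem repUf_UtoUf (l₁ l₂ : ℂ) (u : U) : repUf l₁ l₂ (UtoUf u) = Coeffs.rep l₁ l₂ u :=
  OreLocalization.universalHom_commutes (Coeffs.rep l₁ l₂).toRingHom (powersToUnits l₁ l₂)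
    (powersToUnits_coe l₁ l₂)

/-- The functions that vanish where the first variable is negative, as a `U`-submodule. -/
def nonnegSubmodule (l₁ l₂ : ℂ) : Submodule U (CoeffMod l₁ l₂) where
  carrier := {φ | (show Coeffs from φ) ∈ Coeffs.nonneg}
  zero_mem' := Coeffs.nonneg.zero_mem
  add_mem' := fun ha hb => Coeffs.nonneg.add_mem ha hb
  smul_mem' := fun u φ hφ => Coeffs.rep_mem_nonneg l₁ l₂ u φ hφ

/-- The map from `S_f ⊗ Δ` to the model of its target. -/
def tensorToCoeff (l₁ l₂ : ℂ) :
    BalancedTensor U U Sf (Verma l₁ l₂) →ₗ[U] CoeffMod l₁ l₂ ⧸ nonnegSubmodule l₁ l₂ :=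
  balancedLift
    (imageU.liftQ
      { toFun := fun x =>
          { toFun := fun m => (nonnegSubmodule l₁ l₂).mkQ
              (show CoeffMod l₁ l₂ from repUf l₁ l₂ x (vermaToCoeff l₁ l₂ m))
            map_add' := fun m m' => by
              rw [map_add]
              exact (congrArg _ (map_add (repUf l₁ l₂ x) _ _)).trans (map_add _ _ _)
            map_smul' := fun c m => by
              rw [LinearMap.map_smul_of_tower]
              exact (congrArg _ (map_smul (repUf l₁ l₂ x) c _)).trans
                (Submodule.Quotient.mk_smul (nonnegSubmodule l₁ l₂) c (show CoeffMod l₁ l₂ from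
                  repUf l₁ l₂ x (vermaToCoeff l₁ l₂ m))) }
        map_add' := fun x y => LinearMap.ext fun m => by
          simp only [map_add]; rfl
        map_smul' := fun u x => LinearMap.ext fun m => by
          rw [smul_Uf_eq]
          simp only [map_mul, repUf_UtoUf]; rfl } <| by
      intro x hx
      -- Elements of `U` keep the image of the Verma module inside the functions supported on `i ≥
      -- 0`, so the map factors through `U_(f) / U`.
      obtain ⟨u, rfl⟩ := mem_imageU.1 hx
      refine LinearMap.mem_ker.2 (LinearMap.ext fun m => ?_)
      refine (Submodule.Quotient.mk_eq_zero _).2 ?_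
      rw [repUf_UtoUf]
      exact Coeffs.rep_mem_nonneg l₁ l₂ u _ (vermaToCoeff_mem_nonneg l₁ l₂ m)) <| by
    intro x r m
    induction x using Submodule.Quotient.induction_on with | _ x =>
    change (nonnegSubmodule l₁ l₂).mkQ (show CoeffMod l₁ l₂ from
        repUf l₁ l₂ (x * UtoUf r) (vermaToCoeff l₁ l₂ m)) =
      (nonnegSubmodule l₁ l₂).mkQ (show CoeffMod l₁ l₂ from
        repUf l₁ l₂ x (vermaToCoeff l₁ l₂ (r • m)))
    rw [map_mul, map_smul, repUf_UtoUf]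
    rfl

theorem tensorToCoeff_btmul (l₁ l₂ : ℂ) (x : Uf) (m : Verma l₁ l₂) :
    tensorToCoeff l₁ l₂ (btmul U U (Submodule.Quotient.mk x : Sf) m) =
      (nonnegSubmodule l₁ l₂).mkQ
        (show CoeffMod l₁ l₂ from repUf l₁ l₂ x (vermaToCoeff l₁ l₂ m)) := rfl

/-! ## A vector of the completion -/

/-- The inverse of `f` in `U_(f)`. -/
def fInv : Uf := (1 : U) /ₒ (⟨fU, 1, pow_one fU⟩ : Submonoid.powers fU)

theorem fU_mul_fInv : UtoUf fU * fInv = 1 :=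
  (OreLocalization.mul_cancel (r := (1 : U)) (s := (⟨fU, 1, pow_one fU⟩ : Submonoid.powers fU))
    (t := 1)).trans OreLocalization.one_def.symm

theorem fInv_mul_fU : fInv * UtoUf fU = 1 := by
  have hu : IsUnit (UtoUf fU) :=
    OreLocalization.numerator_isUnit (⟨fU, 1, pow_one fU⟩ : Submonoid.powers fU)
  refine hu.mul_left_cancel ?_
  rw [← mul_assoc, fU_mul_fInv, one_mul, mul_one]

theorem hU_mul_fInv : UtoUf hU * fInv = fInv * UtoUf hU + 2 • fInv := by
  -- Multiplying a relation by `f⁻¹` on both sides turns a commutator with `f` into one with `f⁻¹`.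
  have h := congrArg (fun x => fInv * UtoUf x * fInv) schRel_U.hf
  simp only [map_mul, map_sub, map_nsmul, mul_sub, sub_mul, mul_assoc, fU_mul_fInv, mul_one,
    smul_mul_assoc, mul_smul_comm] at h
  rw [← mul_assoc fInv (UtoUf fU), fInv_mul_fU, one_mul] at h
  rw [h, sub_add_cancel]

theorem eU_mul_fInv :
    UtoUf eU * fInv = fInv * UtoUf eU - (fInv ^ 2 * UtoUf hU + 2 • fInv ^ 2) := by
  have h := congrArg (fun x => fInv * UtoUf x * fInv) schRel_U.ef
  simp only [map_mul, map_add, mul_add, add_mul, mul_assoc, fU_mul_fInv, mul_one, hU_mul_fInv] at h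
  rw [← mul_assoc fInv (UtoUf fU), fInv_mul_fU, one_mul, mul_smul_comm, ← mul_assoc fInv fInv,
    ← pow_two] at h
  rw [h, add_sub_cancel_right]

theorem eU_mul_fInv_pow (i : ℕ) : UtoUf eU * fInv ^ i = fInv ^ i * UtoUf eU -
    (i • (fInv ^ (i + 1) * UtoUf hU) + (i * (i + 1)) • fInv ^ (i + 1)) := by
  induction i with
  | zero => simp
  | succ i ih =>
    rw [pow_succ fInv i, ← mul_assoc, ih, sub_mul, mul_assoc (fInv ^ i), eU_mul_fInv, add_mul,
      smul_mul_assoc, smul_mul_assoc, mul_assoc _ (UtoUf hU), hU_mul_fInv]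
    simp only [mul_sub, mul_add, mul_smul_comm, ← mul_assoc, ← pow_succ, ← pow_add]
    module

/-- The class of `f ^ (-i) ⊗ m`. -/
def fracTensor {M : Type*} [AddCommGroup M] [Module ℂ M] [Module U M] (i : ℕ) (m : M) :
    BalancedTensor U U Sf M :=
  btmul U U (Submodule.Quotient.mk (fInv ^ i) : Sf) m

section FracTensor

variable {M : Type*} [AddCommGroup M] [Module ℂ M] [Module U M]

theorem fracTensor_smul (i : ℕ) (c : ℂ) (m : M) : fracTensor i (c • m) = c • fracTensor i m :=
  btmul_smul_right _ _ _

theorem fracTensor_zero (i : ℕ) : fracTensor i (0 : M) = 0 := by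
  have := fracTensor_smul i 0 (0 : M)
  rwa [zero_smul, zero_smul] at this

theorem btmul_nsmul_left (k : ℕ) (b : Sf) (m : M) :
    btmul U U (k • b) m = (k : ℂ) • btmul U U b m := by
  rw [← btmul_smul_left, Nat.cast_smul_eq_nsmul]

theorem btmul_add_left (b b' : Sf) (m : M) :
    btmul U U (b + b') m = btmul U U b m + btmul U U b' m := by
  simp [btmul, TensorProduct.add_tmul]

/-- The element `e` is commuted past `f^(-i)`; the factors `e` and `h` then on the right lie in `U`
and cross the tensor sign. -/
theorem eU_smul_fracTensor (i : ℕ) (m : M) : eU • fracTensor i m = fracTensor i (eU • m) -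
    ((i : ℂ) • fracTensor (i + 1) (hU • m) + ((i : ℂ) * (i + 1)) • fracTensor (i + 1) m) := by
  have hop : ∀ (k : ℕ) (u : U), btmul U U (Submodule.Quotient.mk (fInv ^ k * UtoUf u) : Sf) m =
      fracTensor k (u • m) := fun k u => btmul_op_smul (Submodule.Quotient.mk (fInv ^ k)) u m
  rw [fracTensor, smul_btmul, ← Submodule.Quotient.mk_smul, smul_Uf_eq, eU_mul_fInv_pow,
    Submodule.Quotient.mk_sub, Submodule.Quotient.mk_add, btmul_sub_left, btmul_add_left, hop]
  have hns : ∀ (k : ℕ) (x : Uf), (Submodule.Quotient.mk (k • x) : Sf) =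
      k • Submodule.Quotient.mk x := fun k x => map_nsmul (Submodule.mkQ imageU) k x
  rw [hns, hns, btmul_nsmul_left, btmul_nsmul_left, hop]
  push_cast
  rfl

end FracTensor

variable {l₁ l₂ : ℂ}

theorem hU_smul_qU_pow (j : ℕ) :
    hU • qU ^ j • hwVec l₁ l₂ = (l₁ - j) • qU ^ j • hwVec l₁ l₂ := by
  induction j with
  | zero => simp [hU_smul_hwVec]
  | succ j ih =>
    rw [pow_succ', mul_smul, ← mul_smul hU, schRel_U.hq, sub_smul, mul_smul, ih, smul_smul_comm]
    generalize qU • qU ^ j • hwVec l₁ l₂ = x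
    push_cast
    module

theorem pU_smul_qU_pow (j : ℕ) :
    pU • qU ^ (j + 1) • hwVec l₁ l₂ = ((j + 1) * l₂) • qU ^ j • hwVec l₁ l₂ := by
  induction j with
  | zero =>
    rw [zero_add, pow_one, ← mul_smul, schRel_U.pq, add_smul, mul_smul, pU_smul_hwVec, smul_zero,
      zU_smul_hwVec]
    simp
  | succ j ih =>
    rw [pow_succ', mul_smul, ← mul_smul pU, schRel_U.pq, add_smul, mul_smul, ih, smul_smul_comm,
      ← mul_smul qU, ← pow_succ', smul_eq_of_mem_center zU_mem_center (zU_smul_hwVec l₁ l₂)]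
    generalize qU ^ (j + 1) • hwVec l₁ l₂ = x
    push_cast
    module

theorem eU_smul_qU : eU • qU ^ 1 • hwVec l₁ l₂ = 0 := by
  rw [pow_one, ← mul_smul, schRel_U.eq, add_smul, mul_smul, eU_smul_hwVec, pU_smul_hwVec,
    smul_zero, add_zero]

theorem eU_smul_qU_pow (j : ℕ) :
    eU • qU ^ (j + 2) • hwVec l₁ l₂ = ((j + 2) * (j + 1) / 2 * l₂) • qU ^ j • hwVec l₁ l₂ := by
  induction j with
  | zero =>
    rw [zero_add, pow_succ', mul_smul, ← mul_smul eU, schRel_U.eq, add_smul, mul_smul, eU_smul_qU,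
      smul_zero, pU_smul_qU_pow]
    simp
  | succ j ih =>
    rw [pow_succ', mul_smul, ← mul_smul eU, schRel_U.eq, add_smul, mul_smul, ih, smul_smul_comm,
      ← mul_smul qU, ← pow_succ', pU_smul_qU_pow]
    generalize qU ^ (j + 1) • hwVec l₁ l₂ = x
    push_cast
    module

/-- The coefficients of a vector of the completion that is killed by `e`. -/
def extCoeff (n : ℕ) (l₂ : ℂ) : ℕ → ℂ
  | 0 => 1
  -- Chosen to cancel the coefficient of `f^(-k-2) ⊗ q^(2k+1) v` after applying `e`: for `l₁ = n -
  -- 1`, term `k` contributes `-(k+1)(n-k)` and term `k+1` contributes `(k+1)(2k+3) l₂`.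
  | k + 1 => (n - k) / (l₂ * (2 * k + 3)) * extCoeff n l₂ k

/-- A vector of the completion that is killed by `e`. -/
def extVec (n : ℕ) (l₁ l₂ : ℂ) : BalancedTensor U U Sf (Verma l₁ l₂) :=
  ∑ k ∈ Finset.range (n + 1),
    extCoeff n l₂ k • fracTensor (k + 1) (qU ^ (2 * k + 1) • hwVec l₁ l₂)

/-- The sum telescopes: a partial sum up to `m` leaves a single term with factor `n - m`, which
vanishes at `m = n`. This is where the integrality of the highest weight enters. -/
theorem eU_smul_extVec (n : ℕ) (hl₂ : l₂ ≠ 0) (hl₁ : l₁ = n - 1) : eU • extVec n l₁ l₂ = 0 := by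
  have key : ∀ m : ℕ, eU • ∑ k ∈ Finset.range (m + 1),
      extCoeff n l₂ k • fracTensor (k + 1) (qU ^ (2 * k + 1) • hwVec l₁ l₂) =
      (-(extCoeff n l₂ m * (m + 1) * (n - m))) •
        fracTensor (m + 2) (qU ^ (2 * m + 1) • hwVec l₁ l₂) := by
    intro m
    induction m with
    | zero =>
      rw [zero_add, Finset.sum_range_one, smul_smul_comm, eU_smul_fracTensor, hU_smul_qU_pow,
        fracTensor_smul, mul_zero, zero_add, eU_smul_qU, fracTensor_zero, hl₁]
      push_cast
      module
    | succ m ih =>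
      have h3 : (2 * (m : ℂ) + 3) ≠ 0 := by exact_mod_cast (by omega : 2 * m + 3 ≠ 0)
      rw [Finset.sum_range_succ, smul_add, ih, smul_smul_comm, eU_smul_fracTensor, hU_smul_qU_pow,
        fracTensor_smul, show 2 * (m + 1) + 1 = 2 * m + 1 + 2 by ring, eU_smul_qU_pow,
        fracTensor_smul, hl₁]
      have hrec : extCoeff n l₂ (m + 1) * (l₂ * (2 * m + 3)) = (n - m) * extCoeff n l₂ m := by
        rw [extCoeff, mul_right_comm, div_mul_cancel₀ _ (mul_ne_zero hl₂ h3)]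
      push_cast
      match_scalars
      · linear_combination (m + 1 : ℂ) * hrec
      · ring
  rw [extVec, key, sub_self, mul_zero, neg_zero, zero_smul]

theorem repUf_fInv_pow (i : ℕ) (φ : Coeffs) (a b : ℤ) :
    repUf l₁ l₂ (fInv ^ i) φ a b = φ (a + i) b := by
  induction i generalizing a with
  | zero => simp
  | succ i ih =>
    have h1 : repUf l₁ l₂ fInv = Coeffs.shift (-1) := by
      have h := congrArg (repUf l₁ l₂) fU_mul_fInv
      rw [map_mul, repUf_UtoUf, Coeffs.rep_fU, map_one] at h
      rw [← one_mul (repUf l₁ l₂ fInv), ← show Coeffs.shift (-1) * Coeffs.shift 1 = 1 from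
        Coeffs.shiftUnit.inv_val, mul_assoc, h, mul_one]
    rw [pow_succ', map_mul, Module.End.mul_apply, h1, Coeffs.shift_apply, ih]
    congr 1
    push_cast
    ring

theorem rep_qU_pow (j : ℕ) (φ : Coeffs) (a b : ℤ) :
    Coeffs.rep l₁ l₂ (qU ^ j) φ a b = φ a (b - j) := by
  induction j generalizing b with
  | zero => simp
  | succ j ih =>
    rw [pow_succ', map_mul, Module.End.mul_apply, Coeffs.rep_qU, Coeffs.opQ_apply, ih]
    congr 1
    push_cast
    ring

theorem extVec_ne_zero (n : ℕ) : extVec n l₁ l₂ ≠ 0 := by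
  intro h
  let ψ : ℕ → Coeffs := fun k => extCoeff n l₂ k •
    repUf l₁ l₂ (fInv ^ (k + 1)) (Coeffs.rep l₁ l₂ (qU ^ (2 * k + 1)) Coeffs.vac)
  have himg : tensorToCoeff l₁ l₂ (extVec n l₁ l₂) = (nonnegSubmodule l₁ l₂).mkQ
      (show CoeffMod l₁ l₂ from ∑ k ∈ Finset.range (n + 1), ψ k) := by
    rw [extVec, map_sum]
    refine Eq.trans ?_ (map_sum (nonnegSubmodule l₁ l₂).mkQ
      (fun k => (show CoeffMod l₁ l₂ from ψ k)) (Finset.range (n + 1))).symm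
    refine Finset.sum_congr rfl fun k _ => ?_
    rw [← fracTensor_smul, fracTensor, tensorToCoeff_btmul, LinearMap.map_smul_of_tower,
      vermaToCoeff_smul_hwVec]
    exact congrArg (nonnegSubmodule l₁ l₂).mkQ (map_smul (repUf l₁ l₂ (fInv ^ (k + 1)))
      (extCoeff n l₂ k) (Coeffs.rep l₁ l₂ (qU ^ (2 * k + 1)) Coeffs.vac))
  rw [h, map_zero] at himg
  have hmem := (Submodule.Quotient.mk_eq_zero (nonnegSubmodule l₁ l₂)).1 himg.symm
  -- Term `k` is supported at `(-(k+1), 2k+1)`, so only `k = 0`, with coefficient `1`, is seen at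
  -- `(-1, 1)`.
  have hval : (∑ k ∈ Finset.range (n + 1), ψ k) (-1) 1 = 0 := hmem (-1) (by norm_num) 1
  have hψ : ∀ k, ψ k (-1) 1 = if k = 0 then 1 else 0 := by
    intro k
    simp only [ψ, Pi.smul_apply, repUf_fInv_pow, rep_qU_pow, Coeffs.vac, smul_eq_mul]
    rcases k with _ | k
    · simp [extCoeff]
    · rw [if_neg (by omega), if_neg (by omega), mul_zero]
  rw [Finset.sum_apply, Finset.sum_apply] at hval
  simp [hψ] at hval

theorem extVec_mem_locallyFinite (n : ℕ) (hl₂ : l₂ ≠ 0) (hl₁ : l₁ = n - 1) :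
    extVec n l₁ l₂ ∈ locallyFinite (BalancedTensor U U Sf (Verma l₁ l₂)) := by
  refine (finite_orbitSpan_iff _).2 ⟨Submodule.span ℂ {extVec n l₁ l₂}, inferInstance,
    Submodule.mem_span_singleton_self _, fun y hy => ?_⟩
  obtain ⟨c, rfl⟩ := Submodule.mem_span_singleton.1 hy
  rw [smul_smul_comm, eU_smul_extVec n hl₂ hl₁, smul_zero]
  exact zero_mem _

theorem nontrivial_enAr (n : ℕ) (hl₂ : l₂ ≠ 0) (hl₁ : l₁ = n - 1) :
    Nontrivial (EnAr (Verma l₁ l₂)) :=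
  ⟨⟨⟨extVec n l₁ l₂, extVec_mem_locallyFinite n hl₂ hl₁⟩, 0, fun h =>
    extVec_ne_zero n (congrArg Subtype.val h)⟩⟩

/-! ## The annihilators -/

/-- After multiplication by `4` one side is odd and the other even. The right side is `m² + 2m` for
the half-integer `m = n - 1/2`, the `H`-weight of the highest weight vector of `Δ(n - 1, l₂)`. -/
theorem half_integral_ne (n k : ℕ) :
    (k : ℂ) ^ 2 + 2 * k ≠ ((n : ℂ) ^ 2 + n - 2) + 5 / 4 := by
  intro h
  have h' : ((4 * k ^ 2 + 8 * k + 3 : ℕ) : ℂ) = ((4 * n ^ 2 + 4 * n : ℕ) : ℂ) := by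
    push_cast
    linear_combination 4 * h
  have h'' := Nat.cast_injective h'
  omega

theorem annihilator_verma (n : ℕ) (hl₂ : l₂ ≠ 0) (hl₁ : l₁ ^ 2 + 3 * l₁ = (n : ℂ) ^ 2 + n - 2) :
    Module.annihilator U (Verma l₁ l₂) = centralIdeal l₂ ((n : ℂ) ^ 2 + n - 2) :=
  annihilator_eq_centralIdeal hl₂ (half_integral_ne n) _
    (smul_eq_of_mem_center zU_mem_center (zU_smul_hwVec l₁ l₂))
    (smul_eq_of_mem_center casU_mem_center (hl₁ ▸ casU_smul_hwVec l₁ l₂))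

theorem annihilator_enAr (n : ℕ) (hl₂ : l₂ ≠ 0) (hl₁ : l₁ = n - 1) :
    Module.annihilator U (EnAr (Verma l₁ l₂)) = centralIdeal l₂ ((n : ℂ) ^ 2 + n - 2) := by
  have := nontrivial_enAr n hl₂ hl₁
  have hc : l₁ ^ 2 + 3 * l₁ = (n : ℂ) ^ 2 + n - 2 := by rw [hl₁]; ring
  refine annihilator_eq_centralIdeal hl₂ (half_integral_ne n) _ (fun x => Subtype.ext ?_)
    (fun x => Subtype.ext ?_)
  · exact smul_tensor_eq_of_mem_center zU_mem_center
      (smul_eq_of_mem_center zU_mem_center (zU_smul_hwVec l₁ l₂)) x.1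
  · exact smul_tensor_eq_of_mem_center casU_mem_center
      (smul_eq_of_mem_center casU_mem_center (hc ▸ casU_smul_hwVec l₁ l₂)) x.1

theorem isCentrallyGenerated_centralIdeal (l c : ℂ) : IsCentrallyGenerated (centralIdeal l c) :=
  le_antisymm (Ideal.span_mono fun _ hx => ⟨Ideal.subset_span hx, centralGens_subset_center l c hx⟩)
    (Ideal.span_le.2 fun _ hx => hx.1)

end

end Schroedinger

theorem corollary5p18 (n : ℕ) (l₂ : ℂ) (hl₂ : l₂ ≠ 0) :
    Module.annihilator Schroedinger.U (Schroedinger.V n l₂) =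
        Module.annihilator Schroedinger.U (Schroedinger.Verma (n - 1) l₂) ∧
      Module.annihilator Schroedinger.U (Schroedinger.Verma (n - 1) l₂) =
        Module.annihilator Schroedinger.U (Schroedinger.Verma (-n - 2) l₂) ∧
      Schroedinger.IsCentrallyGenerated
        (Module.annihilator Schroedinger.U (Schroedinger.V n l₂)) := by
  -- `V` is defined for integers by cases; the weight is written with the case distinction so that
  -- the statement matches `V`, and the nonnegative branch gives `n - 1`.
  have h1 := Schroedinger.annihilator_enAr (l₂ := l₂)
    (l₁ := if 0 ≤ (n : ℤ) then ((n : ℤ) : ℂ) - 1 else ((n : ℤ) : ℂ) - 2) n hl₂ (by simp)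
  have h2 := Schroedinger.annihilator_verma (l₂ := l₂) (l₁ := (n : ℂ) - 1) n hl₂ (by ring)
  have h3 := Schroedinger.annihilator_verma (l₂ := l₂) (l₁ := -(n : ℂ) - 2) n hl₂ (by ring)
  refine ⟨h1.trans h2.symm, h2.trans h3.symm, ?_⟩
  rw [h1]
  exact Schroedinger.isCentrallyGenerated_centralIdeal _ _
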